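/- **Setting.** Let $\mathbb{S}$ be a collection of rings and/or abelian groups, let $(\mathbb{P},\mathrm{ar},\mathrm{type},[\![\cdot]\!])$ be a collection of predicates $[\![P]\!]\subseteq S_1\times\dots\times S_m$ with $S_i\in\mathbb{S}$, and let $\mathbf{W}$ be a finite set of weight symbols, each with an arity $\ge 1$ and a type in $\mathbb{S}$. For a finite relational signature $\sigma$, a $(\sigma,\mathbf{W})$-structure $\mathcal{A}$ consists of a finite non-empty universe $A$, relations $R^{\mathcal{A}}\subseteq A^{\mathrm{ar}(R)}$ for $R\in\sigma$, and maps $w^{\mathcal{A}}:A^{\mathrm{ar}(w)}\to \mathrm{type}(w)$ for $w\in\mathbf{W}$ such that $w^{\mathcal{A}}(a_1,\dots,a_m)\neq 0$ implies that $m=1$, or $a_1=\dots=a_m$, or $a_1,\dots,a_m$ all occur in one tuple of some $R^{\mathcal{A}}$. Distinct elements are adjacent in the Gaifman graph of $\mathcal{A}$ if they occur together in a tuple of a relation; the degree of $\mathcal A$ is the maximum degree of this graph, and $N^{\mathcal{A}}_r(X)$ is the set of the elements at distance at most $r$ in it from some element of $X\subseteq A$. A logic over $\sigma$ and $\mathbf{W}$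 is given by formulas with finitely many free variables and an isomorphism-invariant satisfaction relation that depends only on the values of the free variables (first-order logic with weight aggregation and its fragments are examples). A formula is $r$-local if its truth in any $(\sigma,\mathbf{W})$-structure $\mathcal{A}$ at any values $\bar a$ of its free variables agrees with its truth at $\bar a$ in the substructure induced on $N_r^{\mathcal{A}}(\bar a)$ (no condition on formulas without free variables). A Feferman–Vaught decomposition of $\varphi$ in a set $\Psi$ of formulas with respect to a partition $(\bar z;\bar z')$ of its free variables is a finite non-empty set $\Delta$ of pairs $(\alpha(\bar z),\beta(\bar z'))$ of formulas of $\Psi$ such that, for all $(\sigma,\mathbf{W})$-structures $\mathcal{A},\mathcal{B}$ with disjoint universes and all tuples $\bar a$ of $\mathcal{A}$ and $\bar b$ of $\mathcal{B}$, the formula $\varphi$ holds at $(\bar a,\bar b)$ in the disjoint union of $\mathcal{A}$ and $\mathcal{B}$ if and only if $\mathcal{A}\models\alpha[\bar a]$ and $\mathcal{B}\models\beta[\bar b]$ for some $(\alpha,\beta)\in\Delta$. Fix $k,\ell\in\mathbb{N}$. For a set $\Phi$ of formulas $\varphi(\bar x,\bar y)$ with $|\bar x|=k$, $|\bar y|=\ell$,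 let $\mathcal{C}(\Phi,\mathcal{A},k,\ell)$ be the set of all maps $A^k\to\{0,1\}$ of the form $\bar a\mapsto [\![\varphi(\bar a,\bar v)]\!]^{\mathcal{A}}$ with $\varphi\in\Phi$ and $\bar v\in A^\ell$. **Assumption.** Let $\Phi$ be a set of formulas $\varphi(\bar x,\bar y)$ of a logic over $\sigma$ and $\mathbf{W}$. Let $r\in\mathbb{N}$, let $\sigma^*$ be a signature, and let $\Phi^*$ be a finite set of $r$-local formulas $\varphi^*(\bar x,\bar y)$ of a logic over $\sigma^*$ and $\mathbf{W}$ such that: 1. for every $(\sigma,\mathbf{W})$-structure $\mathcal{A}$ there is an *associated* structure, i.e. a $(\sigma^*,\mathbf{W})$-structure $\mathcal{A}^*$ with the same universe such that for every $\varphi\in\Phi$ there is a $\varphi^*\in\Phi^*$ with $\mathcal{A}\models\varphi[\bar a,\bar b]\iff\mathcal{A}^*\models\varphi^*[\bar a,\bar b]$ for all $\bar a\in A^k$, $\bar b\in A^\ell$; 2. every $\varphi^*\in\Phi^*$ has a Feferman–Vaught decomposition in $\Phi^*$ with respect to every partition of its free variables into two non-empty parts; 3. for all $\varphi_1^*,\varphi_2^*\in\Phi^*$,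 the set $\Phi^*$ contains formulas equivalent to $\neg\varphi_1^*$ and to $\varphi_1^*\vee\varphi_2^*$. **Algorithms.** Algorithms have only *local access* to $\mathcal{A}^*$: they access it only by the queries "Is $\bar a\in R^{\mathcal{A}^*}$?", "Return $w^{\mathcal{A}^*}(\bar a)$" and "Return a list of all neighbours of $a$ in the Gaifman graph of $\mathcal{A}^*$", asked about elements that occur in the input or in earlier answers. They are programs of a WHILE language over binary trees whose leaves are nil, elements and weights, with subroutine calls. Every operation (including arithmetic in the members of $\mathbb{S}$ and evaluation of predicates of $\mathbb{P}$) takes one time unit, and in addition every name of an element that is compared, passed to a query or returned by a query takes $\lfloor\log_2 |A|\rfloor+1$ time units. **Theorem (Exact Learning with Precomputation).** There are constants $C,c\in\mathbb{N}$, depending only on the data fixed above, such that for every family of programs $(\mathrm{mc}_{\varphi^*})_{\varphi^*\in\Phi^*}$ with local access there is a program $\mathfrak{L}$ with local access for which the following holds. Let $\mathcal{A}$ be a $(\sigma,\mathbf{W})$-structure and let $\mathcal{A}^*$ be a structure associated with $\mathcal{A}$, of size $n$ and degree $d$. Let $f_{\Phi^*}(\mathcal{A}^*)\geq 1$ be an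 upper bound on the time of model checking for the formulas in $\Phi^*$ on $\mathcal{A}^*$; that is, for all $\varphi^*\in\Phi^*$, $\bar a\in A^k$ and $\bar v\in A^\ell$, the program $\mathrm{mc}_{\varphi^*}$ on input $(\bar a,\bar v)$ with local access to $\mathcal{A}^*$ decides within time $f_{\Phi^*}(\mathcal{A}^*)$ whether $\mathcal{A}^*\models\varphi^*[\bar a,\bar v]$. Let $T=((\bar a_1,b_1),\dots,(\bar a_t,b_t))\in(A^k\times\{0,1\})^t$ be a training sequence, where $k,t\geq 1$ or $\ell=0$. Then, on input $T$ and with local access to $\mathcal{A}^*$, the program $\mathfrak{L}$ halts within time $$C\cdot f_{\Phi^*}(\mathcal{A}^*)\cdot(\log n+d+t+1)^{c},\qquad\text{i.e. } f_{\Phi^*}(\mathcal{A}^*)\cdot(\log n+d+t)^{O(1)},$$ where $\log n=\lfloor\log_2 n\rfloor$, and * either it returns a formula $\varphi^*\in\Phi^*$ and a tuple $\bar v^*\in A^\ell$, with all entries in the $(2r+1)\ell$-neighbourhood in $\mathcal{A}^*$ of the set of elements that occur in $\bar a_1,\dots,\bar a_t$, such that $[\![\varphi^*(\bar a_i,\bar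 v^*)]\!]^{\mathcal{A}^*}=b_i$ for all $i\in\{1,\dots,t\}$; * or it rejects, and no $h\in\mathcal{C}(\Phi,\mathcal{A},k,\ell)$ satisfies $h(\bar a_i)=b_i$ for all $i\in\{1,\dots,t\}$. -/

import Mathlib

universe u v

noncomputable section

/-- A collection of rings and/or abelian groups. -/
structure WeightColl where
  ι : Type
  carrier : ι → Type
  alg : ∀ i, AddCommGroup (carrier i) ⊕ Ring (carrier i)

instance WeightColl.instAddCommGroup (S : WeightColl) (i : S.ι) : AddCommGroup (S.carrier i) :=
  match S.alg i with
  | Sum.inl h => h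
  | Sum.inr h => h.toAddCommGroup

/-- The product of the ring `S i`; there is none if `S i` is only an abelian group. -/
def WeightColl.mul? (S : WeightColl) (i : S.ι) (a b : S.carrier i) : Option (S.carrier i) :=
  match S.alg i with
  | Sum.inl _ => none
  | Sum.inr h => some (h.mul a b)

/-- A predicate collection over `S`. -/
structure PredColl (S : WeightColl) where
  Name : Type
  countable : Countable Name
  ar : Name → ℕ
  ar_pos : ∀ p, 0 < ar p
  type : ∀ p, Fin (ar p) → S.ι
  sem : ∀ p, Set (∀ i : Fin (ar p), S.carrier (type p i))

/-- A (finite, relational) signature; arity `0` is allowed. -/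
structure Sig where
  Rel : Type
  finite : Finite Rel
  ar : Rel → ℕ

/-- A finite set of weight symbols. -/
structure WSig (S : WeightColl) where
  Sym : Type
  finite : Finite Sym
  ar : Sym → ℕ
  ar_pos : ∀ w, 0 < ar w
  type : Sym → S.ι

/-- The data of a structure with universe `V`: an interpretation of the relation symbols and of
the weight symbols. Together with `WStr.IsWeighted` (and `V` finite and nonempty) this is a
`(σ, W)`-structure. Induced substructures are formed on the level of the data. -/
structure WStr {S : WeightColl} (σ : Sig) (W : WSig S) (V : Type) where
  rel : ∀ R : σ.Rel, Set (Fin (σ.ar R) → V)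
  wt : ∀ w : W.Sym, (Fin (W.ar w) → V) → S.carrier (W.type w)

namespace WStr

variable {S : WeightColl} {σ : Sig} {W : WSig S} {V V' : Type}

/-- The locality condition on the weights of a `(σ, W)`-structure. -/
def IsWeighted (A : WStr σ W V) : Prop :=
  ∀ (w : W.Sym) (a : Fin (W.ar w) → V), A.wt w a ≠ 0 →
    W.ar w = 1 ∨ (∀ i j, a i = a j) ∨
      ∃ R : σ.Rel, ∃ b ∈ A.rel R, Set.range a ⊆ Set.range b

/-- The Gaifman graph. -/
def gaifman (A : WStr σ W V) : SimpleGraph V where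
  Adj a b := a ≠ b ∧ ∃ R : σ.Rel, ∃ t ∈ A.rel R, a ∈ Set.range t ∧ b ∈ Set.range t
  symm := ⟨fun _ _ ⟨h, R, t, ht, ha, hb⟩ => ⟨h.symm, R, t, ht, hb, ha⟩⟩
  loopless := ⟨fun _ h => h.1 rfl⟩

/-- The degree of a (finite) structure: the maximum degree of its Gaifman graph. -/
def degree (A : WStr σ W V) : ℕ := ⨆ v : V, (A.gaifman.neighborSet v).ncard

/-- All elements at distance at most `r` from some element of `X`. -/
def ball (A : WStr σ W V) (r : ℕ) (X : Set V) : Set V :=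
  {b | ∃ a ∈ X, A.gaifman.edist a b ≤ r}

/-- The induced substructure. -/
def induce (A : WStr σ W V) (B : Set V) : WStr σ W B where
  rel R := {t | (fun i => (t i : V)) ∈ A.rel R}
  wt w t := A.wt w (fun i => (t i : V))

open Classical in
/-- The disjoint union. -/
def dunion (A : WStr σ W V) (B : WStr σ W V') : WStr σ W (V ⊕ V') where
  rel R := {c | (∃ a ∈ A.rel R, c = Sum.inl ∘ a) ∨ (∃ b ∈ B.rel R, c = Sum.inr ∘ b)}
  wt w c :=
    if h : ∃ a, c = Sum.inl ∘ a then A.wt w h.choose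
    else if h : ∃ b, c = Sum.inr ∘ b then B.wt w h.choose
    else 0

/-- `e` is an isomorphism from `A` to `B`. -/
def IsIso (e : V ≃ V') (A : WStr σ W V) (B : WStr σ W V') : Prop :=
  (∀ R t, t ∈ A.rel R ↔ e ∘ t ∈ B.rel R) ∧ (∀ w t, A.wt w t = B.wt w (e ∘ t))

end WStr

/-- A logic over the signature `σ` and the weight symbols `W`: formulas with finitely many free
variables (the variables are the natural numbers) and a satisfaction relation on finite structures
with assignments that depends only on the values of the free variables and is invariant under
isomorphism. -/
structure WLogic {S : WeightColl} (σ : Sig) (W : WSig S) where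
  Formula : Type u
  free : Formula → Finset ℕ
  Sat : ∀ {V : Type} [Finite V], WStr σ W V → (ℕ → V) → Formula → Prop
  sat_congr : ∀ {V : Type} [Finite V] (A : WStr σ W V) (β β' : ℕ → V) (φ : Formula),
    (∀ x ∈ free φ, β x = β' x) → (Sat A β φ ↔ Sat A β' φ)
  sat_iso : ∀ {V V' : Type} [Finite V] [Finite V'] (e : V ≃ V') (A : WStr σ W V)
    (B : WStr σ W V') (β : ℕ → V) (φ : Formula),
    WStr.IsIso e A B → (Sat A β φ ↔ Sat B (e ∘ β) φ)

/-! ### First-order logic with weight aggregation is a logic in this sense -/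

section WA

variable {S : WeightColl}

/-- `S i` is a ring and not just an abelian group. -/
def WeightColl.IsRing (S : WeightColl) (i : S.ι) : Prop := (S.alg i).isRight

/-- A factor of a weight product of type `i`. -/
inductive WFactor (W : WSig S) : S.ι → Type
  | const {i : S.ι} (s : S.carrier i) : WFactor W i
  | weight (w : W.Sym) (y : Fin (W.ar w) → ℕ) (hy : Function.Injective y) : WFactor W (W.type w)

/-- A weight product of type `i`: the product of the list `head :: tail`, of length one unless
`S i` is a ring. -/
structure WProduct (W : WSig S) (i : S.ι) where
  head : WFactor W i
  tail : List (WFactor W i)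
  group : ¬ S.IsRing i → tail = []

/-- Formulas (index `none`) and terms of type `i` (index `some i`). -/
inductive WAExpr (σ : Sig) (W : WSig S) (P : PredColl S) : Option S.ι → Type
  | eq (x y : ℕ) : WAExpr σ W P none
  | rel (R : σ.Rel) (x : Fin (σ.ar R) → ℕ) : WAExpr σ W P none
  | wtEq (w : W.Sym) (s : S.carrier (W.type w)) (x : Fin (W.ar w) → ℕ)
      (hx : Function.Injective x) : WAExpr σ W P none
  | neg (φ : WAExpr σ W P none) : WAExpr σ W P none
  | or (φ ψ : WAExpr σ W P none) : WAExpr σ W P none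
  | ex (y : ℕ) (φ : WAExpr σ W P none) : WAExpr σ W P none
  | sumEq (w : W.Sym) (s : S.carrier (W.type w)) (y : Fin (W.ar w) → ℕ)
      (hy : Function.Injective y) (φ : WAExpr σ W P none) : WAExpr σ W P none
  | pred (p : P.Name) (t : ∀ i : Fin (P.ar p), WAExpr σ W P (some (P.type p i))) :
      WAExpr σ W P none
  | const {i : S.ι} (s : S.carrier i) : WAExpr σ W P (some i)
  | weight (w : W.Sym) (x : Fin (W.ar w) → ℕ) (hx : Function.Injective x) :
      WAExpr σ W P (some (W.type w))
  | add {i : S.ι} (t t' : WAExpr σ W P (some i)) : WAExpr σ W P (some i)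
  | sub {i : S.ι} (t t' : WAExpr σ W P (some i)) : WAExpr σ W P (some i)
  | mul {i : S.ι} (h : S.IsRing i) (t t' : WAExpr σ W P (some i)) : WAExpr σ W P (some i)
  | sum {i : S.ι} (p : WProduct W i) (φ : WAExpr σ W P none) : WAExpr σ W P (some i)

variable {σ : Sig} {W : WSig S} {P : PredColl S} {V V' : Type}

def WFactor.vars : ∀ {i : S.ι}, WFactor W i → Finset ℕ
  | _, .const _ => ∅
  | _, .weight _ y _ => Finset.univ.image y

def WProduct.vars {i : S.ι} (p : WProduct W i) : Finset ℕ :=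
  (p.head :: p.tail).foldr (fun t Y => t.vars ∪ Y) ∅

def WFactor.eval (A : WStr σ W V) (β : ℕ → V) : ∀ {i : S.ι}, WFactor W i → S.carrier i
  | _, .const s => s
  | _, .weight w y _ => A.wt w (β ∘ y)

/-- Multiplication, with value `0` where there is none. -/
def WeightColl.mul (S : WeightColl) (i : S.ι) (a b : S.carrier i) : S.carrier i :=
  (S.mul? i a b).getD 0

def WProduct.eval (A : WStr σ W V) (β : ℕ → V) {i : S.ι} (p : WProduct W i) : S.carrier i :=
  p.tail.foldl (fun s t => S.mul i s (t.eval A β)) (p.head.eval A β)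

namespace WAExpr

def free : ∀ {o : Option S.ι}, WAExpr σ W P o → Finset ℕ
  | _, eq x y => {x, y}
  | _, rel _ x => Finset.univ.image x
  | _, wtEq _ _ x _ => Finset.univ.image x
  | _, neg φ => φ.free
  | _, or φ ψ => φ.free ∪ ψ.free
  | _, ex y φ => φ.free \ {y}
  | _, sumEq _ _ y _ φ => φ.free \ Finset.univ.image y
  | _, pred _ t => Finset.univ.biUnion fun i => (t i).free
  | _, const _ => ∅
  | _, weight _ x _ => Finset.univ.image x
  | _, add t t' => t.free ∪ t'.free
  | _, sub t t' => t.free ∪ t'.free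
  | _, mul _ t t' => t.free ∪ t'.free
  | _, sum p φ => φ.free \ p.vars

/-- Truth values for formulas, elements of `S i` for terms of type `i`. -/
abbrev Den (S : WeightColl) : Option S.ι → Type
  | none => Prop
  | some i => S.carrier i

open Classical in
/-- The semantics. `Function.extend y a β` is the assignment `β` with the variables `y` reset to
the values `a`. -/
def eval (A : WStr σ W V) : ∀ {o : Option S.ι}, WAExpr σ W P o → (ℕ → V) → Den S o
  | _, eq x y, β => (β x = β y : Prop)
  | _, rel R x, β => (β ∘ x ∈ A.rel R : Prop)
  | _, wtEq w s x _, β => (s = A.wt w (β ∘ x) : Prop)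
  | _, neg φ, β => (¬ (φ.eval A β : Prop) : Prop)
  | _, or φ ψ, β => ((φ.eval A β : Prop) ∨ (ψ.eval A β : Prop) : Prop)
  | _, ex y φ, β => (∃ a : V, (φ.eval A (Function.update β y a) : Prop) : Prop)
  | _, sumEq w s y _ φ, β =>
      (s = ∑ᶠ a : Fin (W.ar w) → V,
        if (φ.eval A (Function.extend y a β) : Prop) then A.wt w a else 0 : Prop)
  | _, pred p t, β => ((fun i => ((t i).eval A β : S.carrier _)) ∈ P.sem p : Prop)
  | _, const s, _ => s
  | _, weight w x _, β => A.wt w (β ∘ x)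
  | _, add (i := i) t t', β => ((t.eval A β : S.carrier i) + (t'.eval A β : S.carrier i) :)
  | _, sub (i := i) t t', β => ((t.eval A β : S.carrier i) - (t'.eval A β : S.carrier i) :)
  | _, mul (i := i) _ t t', β => S.mul i (t.eval A β) (t'.eval A β)
  | _, sum (i := i) p φ, β =>
      (∑ᶠ a : p.vars → V,
        if (φ.eval A (Function.extend Subtype.val a β) : Prop)
        then p.eval A (Function.extend Subtype.val a β) else 0 : S.carrier i)

end WAExpr

theorem extend_comp_equiv {ι' : Type} (e : V → V') (y : ι' → ℕ) (a : ι' → V) (β : ℕ → V) :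
    Function.extend y (e ∘ a) (e ∘ β) = e ∘ Function.extend y a β := by
  classical
  funext z
  by_cases h : ∃ i, y i = z
  · simp [Function.extend, h]
  · simp [Function.extend, h]

theorem WProduct.eval_iso (e : V ≃ V') (A : WStr σ W V) (B : WStr σ W V') (h : WStr.IsIso e A B)
    (β : ℕ → V) {i : S.ι} (p : WProduct W i) : p.eval B (e ∘ β) = p.eval A β := by
  have key : ∀ {i : S.ι} (t : WFactor W i), t.eval B (e ∘ β) = t.eval A β := by
    intro i t
    cases t with
    | const s => rfl
    | weight w y hy => simp [WFactor.eval, h.2, Function.comp_assoc]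
  simp [WProduct.eval, key]

theorem WAExpr.eval_iso (e : V ≃ V') (A : WStr σ W V) (B : WStr σ W V') (h : WStr.IsIso e A B)
    {o : Option S.ι} (ξ : WAExpr σ W P o) :
    ∀ β : ℕ → V, ξ.eval B (e ∘ β) = ξ.eval A β := by
  induction ξ with
  | eq x y => intro β; simp [eval]
  | rel R x => intro β; simp [eval, h.1, Function.comp_assoc]
  | wtEq w s x hx => intro β; simp [eval, h.2, Function.comp_assoc]
  | neg φ ih => intro β; simp [eval, ih]
  | or φ ψ ih ih' => intro β; simp [eval, ih, ih']
  | ex y φ ih =>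
    intro β
    simp only [eval]
    refine propext ⟨?_, ?_⟩
    · rintro ⟨a, ha⟩
      refine ⟨e.symm a, ?_⟩
      rw [← ih]
      convert ha using 2
      rw [Function.comp_update]; simp
    · rintro ⟨a, ha⟩
      refine ⟨e a, ?_⟩
      rw [← Function.comp_update, ih]; exact ha
  | sumEq w s y hy φ ih =>
    intro β
    simp only [eval]
    congr 1
    rw [← finsum_comp_equiv (Equiv.arrowCongr (Equiv.refl (Fin (W.ar w))) e)]
    refine finsum_congr fun a => ?_
    have : (Equiv.arrowCongr (Equiv.refl (Fin (W.ar w))) e) a = e ∘ a := rfl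
    rw [this, extend_comp_equiv, ih, ← h.2]
  | pred p t ih => intro β; simp only [eval, ih]
  | const s => intro β; rfl
  | weight w x hx => intro β; simp [eval, h.2, Function.comp_assoc]
  | add t t' ih ih' => intro β; simp only [eval, ih, ih']
  | sub t t' ih ih' => intro β; simp only [eval, ih, ih']
  | mul hr t t' ih ih' => intro β; simp only [eval, ih, ih']
  | sum p φ ih =>
    intro β
    simp only [eval]
    rw [← finsum_comp_equiv (Equiv.arrowCongr (Equiv.refl p.vars) e)]
    refine finsum_congr fun a => ?_
    have : (Equiv.arrowCongr (Equiv.refl p.vars) e) a = e ∘ a := rfl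
    rw [this, extend_comp_equiv, ih, WProduct.eval_iso e A B h]

theorem extend_congr {ι' : Type} (y : ι' → ℕ) (a : ι' → V) (β β' : ℕ → V) (z : ℕ)
    (h : (∀ i, y i ≠ z) → β z = β' z) : Function.extend y a β z = Function.extend y a β' z := by
  classical
  by_cases hz : ∃ i, y i = z
  · simp [Function.extend, hz]
  · simpa [Function.extend, hz] using h (by simpa using hz)

theorem WProduct.eval_congr (A : WStr σ W V) (β β' : ℕ → V) {i : S.ι} (p : WProduct W i)
    (h : ∀ x ∈ p.vars, β x = β' x) : p.eval A β = p.eval A β' := by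
  have key : ∀ {i : S.ι} (t : WFactor W i), (∀ x ∈ t.vars, β x = β' x) →
      t.eval A β = t.eval A β' := by
    intro i t ht
    cases t with
    | const s => rfl
    | weight w y hy =>
      have : β ∘ y = β' ∘ y := funext fun j => ht _ (by simp [WFactor.vars])
      simp [WFactor.eval, this]
  have aux : ∀ (l : List (WFactor W i)) (s : S.carrier i),
      (∀ x ∈ l.foldr (fun t Y => t.vars ∪ Y) ∅, β x = β' x) →
      l.foldl (fun s t => S.mul i s (t.eval A β)) s =
        l.foldl (fun s t => S.mul i s (t.eval A β')) s := by
    intro l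
    induction l with
    | nil => intro s _; rfl
    | cons t l ih =>
      intro s hl
      simp only [List.foldr_cons, Finset.mem_union] at hl
      simp only [List.foldl_cons]
      rw [key t fun x hx => hl x (Or.inl hx), ih _ fun x hx => hl x (Or.inr hx)]
  simp only [WProduct.vars, List.foldr_cons, Finset.mem_union] at h
  rw [WProduct.eval, WProduct.eval, key p.head fun x hx => h x (Or.inl hx),
    aux _ _ fun x hx => h x (Or.inr hx)]

theorem WAExpr.eval_congr (A : WStr σ W V) {o : Option S.ι} (ξ : WAExpr σ W P o) :
    ∀ β β' : ℕ → V, (∀ x ∈ ξ.free, β x = β' x) → ξ.eval A β = ξ.eval A β' := by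
  induction ξ with
  | eq x y => intro β β' h; simp [eval, h x (by simp [free]), h y (by simp [free])]
  | rel R x =>
    intro β β' h
    have : β ∘ x = β' ∘ x := funext fun j => h _ (by simp [free])
    simp [eval, this]
  | wtEq w s x hx =>
    intro β β' h
    have : β ∘ x = β' ∘ x := funext fun j => h _ (by simp [free])
    simp [eval, this]
  | neg φ ih => intro β β' h; simp [eval, ih β β' h]
  | or φ ψ ih ih' =>
    intro β β' h
    simp only [free, Finset.mem_union] at h
    simp [eval, ih β β' fun x hx => h x (Or.inl hx), ih' β β' fun x hx => h x (Or.inr hx)]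
  | ex y φ ih =>
    intro β β' h
    simp only [eval]
    congr 1
    funext a
    refine ih _ _ fun x hx => ?_
    by_cases hxy : x = y
    · subst hxy; simp
    · simpa [Function.update, hxy] using h x (by simp [free, hx, hxy])
  | sumEq w s y hy φ ih =>
    intro β β' h
    simp only [eval]
    congr 1
    refine finsum_congr fun a => ?_
    rw [ih _ (Function.extend y a β') fun x hx => extend_congr _ _ _ _ _ fun hn =>
      h x (by simp [free, hx]; exact hn)]
  | pred p t ih =>
    intro β β' h
    simp only [eval]
    congr 1
    funext i
    exact ih i _ _ fun x hx => h x (by simp only [free, Finset.mem_biUnion]; exact ⟨i, by simp, hx⟩)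
  | const s => intro β β' _; rfl
  | weight w x hx =>
    intro β β' h
    have : β ∘ x = β' ∘ x := funext fun j => h _ (by simp [free])
    simp [eval, this]
  | add t t' ih ih' =>
    intro β β' h
    simp only [free, Finset.mem_union] at h
    simp only [eval, ih β β' fun x hx => h x (Or.inl hx), ih' β β' fun x hx => h x (Or.inr hx)]
  | sub t t' ih ih' =>
    intro β β' h
    simp only [free, Finset.mem_union] at h
    simp only [eval, ih β β' fun x hx => h x (Or.inl hx), ih' β β' fun x hx => h x (Or.inr hx)]
  | mul hr t t' ih ih' =>
    intro β β' h
    simp only [free, Finset.mem_union] at h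
    simp only [eval, ih β β' fun x hx => h x (Or.inl hx), ih' β β' fun x hx => h x (Or.inr hx)]
  | sum p φ ih =>
    intro β β' h
    simp only [eval]
    refine finsum_congr fun a => ?_
    rw [ih _ (Function.extend Subtype.val a β') fun x hx => extend_congr _ _ _ _ _ fun hn =>
      h x (by simp only [free, Finset.mem_sdiff]; exact ⟨hx, fun hp => hn ⟨x, hp⟩ rfl⟩)]
    rw [WProduct.eval_congr A _ (Function.extend Subtype.val a β') p fun x hx =>
      extend_congr _ _ _ _ _ fun hn => absurd rfl (hn ⟨x, hx⟩)]

/-- First-order logic with weight aggregation. -/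
def WA (σ : Sig) (W : WSig S) (P : PredColl S) : WLogic σ W where
  Formula := WAExpr σ W P none
  free φ := φ.free
  Sat A β φ := φ.eval A β
  sat_congr A β β' φ h := by rw [WAExpr.eval_congr A φ β β' h]
  sat_iso e A B β φ h := by rw [WAExpr.eval_iso e A B h φ β]

end WA

/-! ### Locality, decompositions, concepts -/

section Learning

variable {S : WeightColl} {σ σs : Sig} {W : WSig S} {V : Type}

namespace WLogic

/-- `φ` is `r`-local around its free variables. (For a formula without free variables there is no
neighbourhood structure, hence no `β'`, and the condition is void.) -/
def IsLocal (L : WLogic.{u} σ W) (r : ℕ) (φ : L.Formula) : Prop :=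
  ∀ {V : Type} [Finite V] (A : WStr σ W V), A.IsWeighted →
    ∀ (β : ℕ → V) (β' : ℕ → A.ball r (β '' (L.free φ : Set ℕ))),
      (∀ x ∈ L.free φ, (β' x : V) = β x) →
        (L.Sat A β φ ↔ L.Sat (A.induce (A.ball r (β '' (L.free φ : Set ℕ)))) β' φ)

/-- `Δ` is a Feferman-Vaught decomposition of `φ` in `Ψ` with respect to `(Z; Z')`. As `φ` does not
use the two predicates that mark the parts of a disjoint sum, it is evaluated in the disjoint
union. -/
def IsFVDecomposition (L : WLogic.{u} σ W) (Ψ : Set L.Formula) (φ : L.Formula) (Z Z' : Finset ℕ)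
    (Δ : Set (L.Formula × L.Formula)) : Prop :=
  Δ.Finite ∧ Δ.Nonempty ∧
  (∀ p ∈ Δ, p.1 ∈ Ψ ∧ p.2 ∈ Ψ ∧ L.free p.1 ⊆ Z ∧ L.free p.2 ⊆ Z') ∧
  ∀ {V V' : Type} [Finite V] [Finite V'] (A : WStr σ W V) (B : WStr σ W V'),
    A.IsWeighted → B.IsWeighted →
    ∀ (β : ℕ → V) (β' : ℕ → V') (γ : ℕ → V ⊕ V'),
      (∀ z ∈ Z, γ z = Sum.inl (β z)) → (∀ z ∈ Z', γ z = Sum.inr (β' z)) →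
        (L.Sat (A.dunion B) γ φ ↔ ∃ p ∈ Δ, L.Sat A β p.1 ∧ L.Sat B β' p.2)

/-- `A ⊨ φ[a, v]` for a formula `φ(x₁,…,x_k,y₁,…,y_ℓ)`; the variables `x₁,…,x_k,y₁,…,y_ℓ` are
`0,…,k-1,k,…,k+ℓ-1`. -/
def Holds (L : WLogic.{u} σ W) [Finite V] (A : WStr σ W V) (φ : L.Formula) {k ℓ : ℕ}
    (a : Fin k → V) (v : Fin ℓ → V) : Prop :=
  ∀ β : ℕ → V, (∀ i : Fin k, β i = a i) → (∀ j : Fin ℓ, β (k + j) = v j) → L.Sat A β φ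

open Classical in
/-- The concept on `V^k` defined by `φ` and the parameters `v`. -/
def concept (L : WLogic.{u} σ W) [Finite V] (A : WStr σ W V) (φ : L.Formula) {k ℓ : ℕ}
    (v : Fin ℓ → V) : (Fin k → V) → Bool :=
  fun a => decide (L.Holds A φ a v)

/-- The concept class `C(Φ, A, k, ℓ)`. -/
def conceptClass (L : WLogic.{u} σ W) [Finite V] (Φ : Set L.Formula) (A : WStr σ W V)
    (k ℓ : ℕ) : Set ((Fin k → V) → Bool) :=
  {h | ∃ φ ∈ Φ, ∃ v : Fin ℓ → V, h = L.concept A φ v}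

end WLogic

/-- The hypothesis `h` is consistent with the training sequence `T`. -/
def Consistent {k : ℕ} (h : (Fin k → V) → Bool) (T : List ((Fin k → V) × Bool)) : Prop :=
  ∀ p ∈ T, h p.1 = p.2

/-- The elements that occur in the training sequence. -/
def trainingElems {k : ℕ} (T : List ((Fin k → V) × Bool)) : Set V :=
  {a | ∃ p ∈ T, ∃ i, p.1 i = a}

/-- `As` is associated with `A`: every formula of `Φ` on `A` is equivalent to some formula of
`Φs` on `As`. -/
def IsAssociated {L : WLogic.{u} σ W} {Ls : WLogic.{v} σs W} (k ℓ : ℕ) (Φ : Set L.Formula)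
    (Φs : Set Ls.Formula) [Finite V] (A : WStr σ W V) (As : WStr σs W V) : Prop :=
  As.IsWeighted ∧ ∀ φ ∈ Φ, ∃ ψ ∈ Φs, ∀ (a : Fin k → V) (v : Fin ℓ → V),
    L.Holds A φ a v ↔ Ls.Holds As ψ a v

/-- `Φs` is a finite set of `r`-local normal forms for `Φ`: the requirements on `Φ` and `Φs`. -/
structure HasLocalNormalForms {L : WLogic.{u} σ W} {Ls : WLogic.{v} σs W} (k ℓ r : ℕ)
    (Φ : Set L.Formula) (Φs : Set Ls.Formula) : Prop where
  free_subset : ∀ φ ∈ Φ, L.free φ ⊆ Finset.range (k + ℓ)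
  free_subset_star : ∀ φ ∈ Φs, Ls.free φ ⊆ Finset.range (k + ℓ)
  finite : Φs.Finite
  isLocal : ∀ φ ∈ Φs, Ls.IsLocal r φ
  associated : ∀ {V : Type} [Finite V] [Nonempty V] (A : WStr σ W V), A.IsWeighted →
    ∃ As : WStr σs W V, IsAssociated k ℓ Φ Φs A As
  fv : ∀ φ ∈ Φs, ∀ Z Z' : Finset ℕ, Z.Nonempty → Z'.Nonempty → Disjoint Z Z' →
    Z ∪ Z' = Ls.free φ → ∃ Δ, Ls.IsFVDecomposition Φs φ Z Z' Δ
  neg : ∀ φ ∈ Φs, ∃ ψ ∈ Φs, ∀ {V : Type} [Finite V] (A : WStr σs W V), A.IsWeighted →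
    ∀ β : ℕ → V, Ls.Sat A β ψ ↔ ¬ Ls.Sat A β φ
  or : ∀ φ₁ ∈ Φs, ∀ φ₂ ∈ Φs, ∃ ψ ∈ Φs, ∀ {V : Type} [Finite V] (A : WStr σs W V),
    A.IsWeighted → ∀ β : ℕ → V, Ls.Sat A β ψ ↔ (Ls.Sat A β φ₁ ∨ Ls.Sat A β φ₂)

/-! ### Algorithms with local access

Programs of a WHILE language over binary trees. The leaves of the trees are `nil`, elements of the
universe and weights. A program contains no name of an element, so it gets hold of elements only
through its input and through queries for the neighbours of elements that it already has. -/

/-- Values of program variables. -/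
inductive Val (S : WeightColl) (V : Type) : Type
  | nil : Val S V
  | elem (a : V) : Val S V
  | wt (i : S.ι) (s : S.carrier i) : Val S V
  | cons (x y : Val S V) : Val S V

namespace Val

def ofList : List (Val S V) → Val S V
  | [] => nil
  | x :: l => cons x (ofList l)

/-- The list of the elements of a tuple. -/
def tuple {n : ℕ} (a : Fin n → V) : Val S V := ofList (List.ofFn fun i => elem (a i))

/-- Truth values; `nil` is false, and every other value counts as true. -/
def bool (b : Bool) : Val S V := if b then cons nil nil else nil

/-- Natural numbers in unary. -/
def num : ℕ → Val S V
  | 0 => nil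
  | n + 1 => cons nil (num n)

def hd : Val S V → Val S V
  | cons x _ => x
  | _ => nil

def tl : Val S V → Val S V
  | cons _ y => y
  | _ => nil

def isCons : Val S V → Bool
  | cons _ _ => true
  | _ => false

open Classical in
/-- Equality of leaves. -/
def eqLeaf (x y : Val S V) : Val S V := bool (decide (x = y ∧ x.isCons = false))

open Classical in
/-- An operation on weights of the same type. -/
def op (f : ∀ i, S.carrier i → S.carrier i → Option (S.carrier i)) : Val S V → Val S V → Val S V
  | wt i s, wt j s' =>
      if h : j = i then
        match f i s (h ▸ s') with
        | some s'' => wt i s''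
        | none => nil
      else nil
  | _, _ => nil

/-- A training sequence as a list of pairs. -/
def training {k : ℕ} (T : List ((Fin k → V) × Bool)) : Val S V :=
  ofList (T.map fun p => cons (tuple p.1) (bool p.2))

end Val

/-- The expressions of the programming language. -/
inductive PExp (σ : Sig) (W : WSig S) (P : PredColl S) : Type
  | var (x : ℕ)
  | nil
  | cons (e e' : PExp σ W P)
  | hd (e : PExp σ W P)
  | tl (e : PExp σ W P)
  | eq (e e' : PExp σ W P)
  | const (i : S.ι) (s : S.carrier i)
  | add (e e' : PExp σ W P)
  | sub (e e' : PExp σ W P)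
  | mul (e e' : PExp σ W P)
  | pred (p : P.Name) (e : PExp σ W P)
  | rel (R : σ.Rel) (e : PExp σ W P)
  | wt (w : W.Sym) (e : PExp σ W P)
  | nbrs (e : PExp σ W P)

/-- Programs. `call x c e` runs `c` as a subroutine with variables of its own on the value of `e`
and stores the result in `x`. -/
inductive Prog (σ : Sig) (W : WSig S) (P : PredColl S) : Type
  | assign (x : ℕ) (e : PExp σ W P)
  | seq (c c' : Prog σ W P)
  | ite (e : PExp σ W P) (c c' : Prog σ W P)
  | loop (e : PExp σ W P) (c : Prog σ W P)
  | call (x : ℕ) (c : Prog σ W P) (e : PExp σ W P)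

/-- Answers to the queries for the neighbours of an element: lists in an arbitrary order. -/
structure WStr.Access (A : WStr σ W V) where
  nbrs : V → List V
  nodup : ∀ a, (nbrs a).Nodup
  mem_nbrs : ∀ a b, b ∈ nbrs a ↔ A.gaifman.Adj a b

variable {P : PredColl S}

/-- The number of bits of the name of an element. -/
def nameLen (V : Type) : ℕ := Nat.log 2 (Nat.card V) + 1

namespace PExp

open Classical in
/-- The value of an expression; ill-formed queries and operations have the value `nil`. -/
def val {A : WStr σ W V} (acc : A.Access) (s : ℕ → Val S V) : PExp σ W P → Val S V
  | var x => s x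
  | nil => .nil
  | cons e e' => .cons (e.val acc s) (e'.val acc s)
  | hd e => (e.val acc s).hd
  | tl e => (e.val acc s).tl
  | eq e e' => Val.eqLeaf (e.val acc s) (e'.val acc s)
  | const i a => .wt i a
  | add e e' => Val.op (fun _ a b => some (a + b)) (e.val acc s) (e'.val acc s)
  | sub e e' => Val.op (fun _ a b => some (a - b)) (e.val acc s) (e'.val acc s)
  | mul e e' => Val.op S.mul? (e.val acc s) (e'.val acc s)
  | pred p e => Val.bool (decide (∃ t ∈ P.sem p,
      e.val acc s = Val.ofList (List.ofFn fun i => Val.wt (P.type p i) (t i))))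
  | rel R e => Val.bool (decide (∃ t ∈ A.rel R, e.val acc s = Val.tuple t))
  | wt w e =>
      if h : ∃ t : Fin (W.ar w) → V, e.val acc s = Val.tuple t then .wt _ (A.wt w h.choose)
      else .nil
  | nbrs e =>
      match e.val acc s with
      | .elem a => Val.ofList ((acc.nbrs a).map Val.elem)
      | _ => .nil

/-- The time for the evaluation of an expression: every operation takes one unit of time, and in
addition every name of an element that is compared, passed to a query or returned by a query takes
its length. -/
def cost {A : WStr σ W V} (acc : A.Access) (s : ℕ → Val S V) : PExp σ W P → ℕ
  | var _ => 1
  | nil => 1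
  | cons e e' => e.cost acc s + e'.cost acc s + 1
  | hd e => e.cost acc s + 1
  | tl e => e.cost acc s + 1
  | eq e e' => e.cost acc s + e'.cost acc s + 1 + 2 * nameLen V
  | const _ _ => 1
  | add e e' => e.cost acc s + e'.cost acc s + 1
  | sub e e' => e.cost acc s + e'.cost acc s + 1
  | mul e e' => e.cost acc s + e'.cost acc s + 1
  | pred _ e => e.cost acc s + 1
  | rel R e => e.cost acc s + 1 + σ.ar R * nameLen V
  | wt w e => e.cost acc s + 1 + W.ar w * nameLen V
  | nbrs e => e.cost acc s + 1 +
      match e.val acc s with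
      | .elem a => ((acc.nbrs a).length + 1) * nameLen V
      | _ => 0

end PExp

/-- The store in which variable `0` holds the input. -/
def initStore (x : Val S V) : ℕ → Val S V := Function.update (fun _ => Val.nil) 0 x

/-- `Exec acc c s s' t`: started in the store `s`, the program `c` halts after time `t` in the
store `s'`. -/
inductive Exec {A : WStr σ W V} (acc : A.Access) :
    Prog σ W P → (ℕ → Val S V) → (ℕ → Val S V) → ℕ → Prop
  | assign (x : ℕ) (e : PExp σ W P) (s : ℕ → Val S V) :
      Exec acc (.assign x e) s (Function.update s x (e.val acc s)) (e.cost acc s + 1)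
  | seq {c c' : Prog σ W P} {s s' s'' : ℕ → Val S V} {t t' : ℕ} :
      Exec acc c s s' t → Exec acc c' s' s'' t' → Exec acc (.seq c c') s s'' (t + t')
  | ite_true {e : PExp σ W P} {c c' : Prog σ W P} {s s' : ℕ → Val S V} {t : ℕ} :
      e.val acc s ≠ .nil → Exec acc c s s' t →
      Exec acc (.ite e c c') s s' (e.cost acc s + 1 + t)
  | ite_false {e : PExp σ W P} {c c' : Prog σ W P} {s s' : ℕ → Val S V} {t : ℕ} :
      e.val acc s = .nil → Exec acc c' s s' t →
      Exec acc (.ite e c c') s s' (e.cost acc s + 1 + t)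
  | loop_done {e : PExp σ W P} {c : Prog σ W P} {s : ℕ → Val S V} :
      e.val acc s = .nil → Exec acc (.loop e c) s s (e.cost acc s + 1)
  | loop_step {e : PExp σ W P} {c : Prog σ W P} {s s' s'' : ℕ → Val S V} {t t' : ℕ} :
      e.val acc s ≠ .nil → Exec acc c s s' t → Exec acc (.loop e c) s' s'' t' →
      Exec acc (.loop e c) s s'' (e.cost acc s + 1 + t + t')
  | call {x : ℕ} {c : Prog σ W P} {e : PExp σ W P} {s s' : ℕ → Val S V} {t : ℕ} :
      Exec acc c (initStore (e.val acc s)) s' t →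
      Exec acc (.call x c e) s (Function.update s x (s' 0)) (e.cost acc s + 1 + t)

/-- Programs are deterministic: the final store and the running time are unique. -/
theorem Exec.unique {A : WStr σ W V} {acc : A.Access} {c : Prog σ W P} {s s₁ s₂ : ℕ → Val S V}
    {t₁ t₂ : ℕ} (h₁ : Exec acc c s s₁ t₁) (h₂ : Exec acc c s s₂ t₂) : s₁ = s₂ ∧ t₁ = t₂ := by
  induction h₁ generalizing s₂ t₂ with
  | assign x e s => cases h₂; exact ⟨rfl, rfl⟩
  | seq _ _ ih ih' =>
    cases h₂ with
    | seq g g' =>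
      obtain ⟨rfl, rfl⟩ := ih g
      obtain ⟨rfl, rfl⟩ := ih' g'
      exact ⟨rfl, rfl⟩
  | ite_true h _ ih =>
    cases h₂ with
    | ite_true _ g => obtain ⟨rfl, rfl⟩ := ih g; exact ⟨rfl, rfl⟩
    | ite_false h' _ => exact absurd h' h
  | ite_false h _ ih =>
    cases h₂ with
    | ite_false _ g => obtain ⟨rfl, rfl⟩ := ih g; exact ⟨rfl, rfl⟩
    | ite_true h' _ => exact absurd h h'
  | loop_done h =>
    cases h₂ with
    | loop_done _ => exact ⟨rfl, rfl⟩
    | loop_step h' _ _ => exact absurd h h'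
  | loop_step h _ _ ih ih' =>
    cases h₂ with
    | loop_done h' => exact absurd h' h
    | loop_step _ g g' =>
      obtain ⟨rfl, rfl⟩ := ih g
      obtain ⟨rfl, rfl⟩ := ih' g'
      exact ⟨rfl, rfl⟩
  | call _ ih =>
    cases h₂ with
    | call g => obtain ⟨rfl, rfl⟩ := ih g; exact ⟨rfl, rfl⟩

/-- On input `x`, the program `c` halts with output `y` after time `t`. -/
def Prog.Runs (c : Prog σ W P) {A : WStr σ W V} (acc : A.Access) (x y : Val S V) (t : ℕ) : Prop :=
  ∃ s, Exec acc c (initStore x) s t ∧ s 0 = y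

/-- Model checking for the formulas `Φs i` on `A` by the programs `mc i` takes time at most `F`:
on input of a tuple `(a, v)`, the program `mc i` decides within this time whether
`A ⊨ Φs i [a, v]`. -/
def ModelChecksWithin {L : WLogic.{u} σ W} {N : ℕ} (k ℓ : ℕ) (Φs : Fin N → L.Formula)
    (mc : Fin N → Prog σ W P) [Finite V] (A : WStr σ W V) (F : ℕ) : Prop :=
  ∀ (acc : A.Access) (i : Fin N) (a : Fin k → V) (v : Fin ℓ → V),
    ∃ (y : Val S V) (t : ℕ), (mc i).Runs acc (Val.tuple (Fin.append a v)) y t ∧ t ≤ F ∧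
      (y ≠ .nil ↔ L.Holds A (Φs i) a v)

end Learning

end

/-! The learner is a brute-force search: it tries every formula of `Φs` with every parameter tuple
from the ball of radius `(2r+1)ℓ` around the training elements, and asks the model checkers about
each example. Its soundness is immediate. What needs proof is that rejection is justified: if some
parameters anywhere in the structure fit the sample, then so do some near ones, possibly with
another formula of `Φs` (`HasLocalNormalForms.exists_near_hypothesis`).

Let `X` be the set of training elements. Collect the parameters that can be reached from `X` in a
chain of jumps of length at most `2r+1`; there are at most `ℓ` jumps, which gives the radius
(`WStr.exists_near_params`). The remaining parameters are more than `2r+1` away from `X` and from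
the collected ones. The `r`-balls around the two groups are therefore disjoint with no edge between
them, so an `r`-local formula cannot tell the structure from two disjoint copies of it, one for each
group (`WStr.exists_iso_ball_dunion`, `WLogic.IsLocal.sat_dunion_iff`). There a Feferman–Vaught
decomposition applies. Its far halves speak of the far parameters only, so their truth values are
the same for all examples. The disjunction of the near halves whose far partners are true is in `Φs`
up to equivalence and no longer mentions the far parameters, which can be reset to an element of
`X`.

For the running time, a ball of fixed radius around `t` examples has at most `t k (d+1)^R` elements
counted with repetition, and `k`, `ℓ`, `r` and the number of formulas are constants. The number of
candidates is thus polynomial in `d + t`, each candidate costs `t` model checks, and the bound `f`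
enters only linearly. The programs are built from one fold over lists, `Prog.fold_runsIn`, with
explicit time bounds. -/

namespace WStr

variable {S : WeightColl} {σ : Sig} {W : WSig S} {V V' : Type}

/-! ### Balls in the Gaifman graph and disjoint unions -/

theorem ball_zero (A : WStr σ W V) (X : Set V) : A.ball 0 X = X := by
  ext b
  simp only [ball, Set.mem_ofPred_eq, Nat.cast_zero, nonpos_iff_eq_zero,
    SimpleGraph.edist_eq_zero_iff]
  exact ⟨fun ⟨a, ha, h⟩ => h ▸ ha, fun h => ⟨b, h, rfl⟩⟩

theorem ball_mono (A : WStr σ W V) {r r' : ℕ} (h : r ≤ r') (X : Set V) :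
    A.ball r X ⊆ A.ball r' X :=
  fun _ ⟨a, ha, hr⟩ => ⟨a, ha, hr.trans (by exact_mod_cast h)⟩

theorem subset_ball (A : WStr σ W V) (r : ℕ) (X : Set V) : X ⊆ A.ball r X :=
  fun a ha => ⟨a, ha, by simp⟩

/-- A shortest walk of length exactly `r + 1` loses its last edge and ends within distance `r`. This
recursion serves both for inductions on the radius and for computing balls by repeated neighbour
queries. -/
theorem mem_ball_succ (A : WStr σ W V) (r : ℕ) (X : Set V) (b : V) :
    b ∈ A.ball (r + 1) X ↔ b ∈ A.ball r X ∨ ∃ c ∈ A.ball r X, A.gaifman.Adj c b := by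
  constructor
  · rintro ⟨a, ha, h⟩
    have hne : A.gaifman.edist a b ≠ ⊤ := ne_top_of_le_ne_top (by simp) h
    obtain ⟨p, hp⟩ := (SimpleGraph.edist_ne_top_iff_reachable.1 hne).exists_walk_length_eq_edist
    have hlen : p.length ≤ r + 1 := by rw [← hp] at h; exact_mod_cast h
    rcases Nat.lt_or_ge p.length (r + 1) with hlt | hge
    · exact Or.inl ⟨a, ha, by rw [← hp]; exact_mod_cast Nat.lt_succ_iff.1 hlt⟩
    · have hnn : ¬ p.Nil := by
        intro hn
        rw [← SimpleGraph.Walk.length_eq_zero_iff] at hn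
        omega
      refine Or.inr ⟨p.penultimate, ⟨a, ha, ?_⟩, p.adj_penultimate hnn⟩
      refine (p.dropLast.edist_le).trans ?_
      have := p.length_dropLast_add_one hnn
      exact_mod_cast (by omega : p.dropLast.length ≤ r)
  · rintro (h | ⟨c, ⟨a, ha, h⟩, hadj⟩)
    · exact A.ball_mono (Nat.le_succ r) X h
    · refine ⟨a, ha, (SimpleGraph.edist_triangle (v := c)).trans ?_⟩
      rw [Nat.cast_add, Nat.cast_one]
      exact add_le_add h (SimpleGraph.edist_eq_one_iff_adj.2 hadj).le

theorem ball_ball (A : WStr σ W V) (r r' : ℕ) (X : Set V) {a b : V}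
    (ha : a ∈ A.ball r X) (h : A.gaifman.edist a b ≤ r') : b ∈ A.ball (r + r') X := by
  obtain ⟨x, hx, hxa⟩ := ha
  refine ⟨x, hx, (SimpleGraph.edist_triangle (v := a)).trans ?_⟩
  rw [Nat.cast_add]
  exact add_le_add hxa h

theorem dunion_wt_inl (A : WStr σ W V) (B : WStr σ W V') (w : W.Sym) (a : Fin (W.ar w) → V) :
    (A.dunion B).wt w (Sum.inl ∘ a) = A.wt w a := by
  have h : ∃ a', (Sum.inl ∘ a : Fin (W.ar w) → V ⊕ V') = Sum.inl ∘ a' := ⟨a, rfl⟩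
  simp only [dunion]
  rw [dif_pos h]
  congr 1
  exact (Sum.inl_injective.comp_left h.choose_spec).symm

theorem dunion_wt_inr (A : WStr σ W V) (B : WStr σ W V') (w : W.Sym) (b : Fin (W.ar w) → V') :
    (A.dunion B).wt w (Sum.inr ∘ b) = B.wt w b := by
  have h : ∃ b', (Sum.inr ∘ b : Fin (W.ar w) → V ⊕ V') = Sum.inr ∘ b' := ⟨b, rfl⟩
  have h' : ¬ ∃ a, (Sum.inr ∘ b : Fin (W.ar w) → V ⊕ V') = Sum.inl ∘ a := by
    rintro ⟨a, ha⟩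
    -- Positive arity matters: an empty tuple would lie in both copies.
    simpa using congrFun ha ⟨0, W.ar_pos w⟩
  simp only [dunion]
  rw [dif_neg h', dif_pos h]
  congr 1
  exact (Sum.inr_injective.comp_left h.choose_spec).symm

theorem dunion_wt_mixed (A : WStr σ W V) (B : WStr σ W V') (w : W.Sym)
    (c : Fin (W.ar w) → V ⊕ V') (h : ¬ ∃ a, c = Sum.inl ∘ a) (h' : ¬ ∃ b, c = Sum.inr ∘ b) :
    (A.dunion B).wt w c = 0 := by
  simp only [dunion]
  rw [dif_neg h, dif_neg h']

theorem IsWeighted.dunion {A : WStr σ W V} {B : WStr σ W V'} (hA : A.IsWeighted)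
    (hB : B.IsWeighted) : (A.dunion B).IsWeighted := by
  intro w c hc
  by_cases h : ∃ a, c = Sum.inl ∘ a
  · obtain ⟨a, rfl⟩ := h
    rw [dunion_wt_inl] at hc
    rcases hA w a hc with h | h | ⟨R, t, ht, hsub⟩
    · exact Or.inl h
    · exact Or.inr (Or.inl fun i j => congrArg Sum.inl (h i j))
    · refine Or.inr (Or.inr ⟨R, Sum.inl ∘ t, Or.inl ⟨t, ht, rfl⟩, ?_⟩)
      rw [Set.range_comp, Set.range_comp]
      exact Set.image_mono hsub
  · by_cases h' : ∃ b, c = Sum.inr ∘ b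
    · obtain ⟨b, rfl⟩ := h'
      rw [dunion_wt_inr] at hc
      rcases hB w b hc with h | h | ⟨R, t, ht, hsub⟩
      · exact Or.inl h
      · exact Or.inr (Or.inl fun i j => congrArg Sum.inr (h i j))
      · refine Or.inr (Or.inr ⟨R, Sum.inr ∘ t, Or.inr ⟨t, ht, rfl⟩, ?_⟩)
        rw [Set.range_comp, Set.range_comp]
        exact Set.image_mono hsub
    · exact absurd (dunion_wt_mixed A B w c h h') hc

theorem dunion_adj (A : WStr σ W V) (B : WStr σ W V') (x y : V ⊕ V') :
    (A.dunion B).gaifman.Adj x y ↔ (∃ a b, x = .inl a ∧ y = .inl b ∧ A.gaifman.Adj a b) ∨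
      (∃ a b, x = .inr a ∧ y = .inr b ∧ B.gaifman.Adj a b) := by
  constructor
  · rintro ⟨hne, R, t, ⟨s, hs, rfl⟩ | ⟨s, hs, rfl⟩, ⟨i, rfl⟩, ⟨j, rfl⟩⟩
    · exact Or.inl ⟨s i, s j, rfl, rfl, fun h => hne (congrArg Sum.inl h), R, s, hs, ⟨i, rfl⟩, ⟨j, rfl⟩⟩
    · exact Or.inr ⟨s i, s j, rfl, rfl, fun h => hne (congrArg Sum.inr h), R, s, hs, ⟨i, rfl⟩, ⟨j, rfl⟩⟩
  · rintro (⟨a, b, rfl, rfl, hne, R, s, hs, ⟨i, rfl⟩, ⟨j, rfl⟩⟩ |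
      ⟨a, b, rfl, rfl, hne, R, s, hs, ⟨i, rfl⟩, ⟨j, rfl⟩⟩)
    · exact ⟨fun h => hne (Sum.inl_injective h), R, Sum.inl ∘ s, Or.inl ⟨s, hs, rfl⟩, ⟨i, rfl⟩, ⟨j, rfl⟩⟩
    · exact ⟨fun h => hne (Sum.inr_injective h), R, Sum.inr ∘ s, Or.inr ⟨s, hs, rfl⟩, ⟨i, rfl⟩, ⟨j, rfl⟩⟩

/-- No edge joins the two sides, so by induction on the radius the ball grows in each of them
separately. -/
theorem ball_dunion (A : WStr σ W V) (B : WStr σ W V') (r : ℕ) (X : Set V) (Y : Set V') :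
    (A.dunion B).ball r (Sum.inl '' X ∪ Sum.inr '' Y) =
      Sum.inl '' A.ball r X ∪ Sum.inr '' B.ball r Y := by
  induction r with
  | zero => simp only [ball_zero]
  | succ r ih =>
    ext z
    rw [mem_ball_succ, ih]
    rcases z with z | z
    · simp [dunion_adj, mem_ball_succ]
    · simp [dunion_adj, mem_ball_succ]

/-- If the sets `X` and `Y` are more than `2r+1` apart, then the substructure induced on their
`r`-neighbourhood is the disjoint union of those induced on the `r`-neighbourhoods of `X` and `Y`.
It is obtained here from two copies of the whole structure. -/
theorem exists_iso_ball_dunion (A : WStr σ W V) (hA : A.IsWeighted) (r : ℕ) (X Y : Set V)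
    (hXY : ∀ x ∈ X, ∀ y ∈ Y, ¬ A.gaifman.edist x y ≤ ((2 * r + 1 : ℕ) : ℕ∞)) :
    ∃ e : (A.dunion A).ball r (Sum.inl '' X ∪ Sum.inr '' Y) ≃ A.ball r (X ∪ Y),
      (∀ z, (e z : V) = Sum.elim id id (z : V ⊕ V)) ∧
      IsIso e ((A.dunion A).induce _) (A.induce _) := by
  -- Source of the constant `2r+1 = r+1+r`: the balls must be not only disjoint but also without an
  -- edge between them, so that no relation tuple meets both.
  have far : ∀ p ∈ A.ball r X, ∀ q ∈ A.ball r Y, ¬ A.gaifman.edist p q ≤ 1 := by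
    rintro p ⟨x, hx, hp⟩ q ⟨y, hy, hq⟩ h
    refine hXY x hx y hy ?_
    have h1 : A.gaifman.edist x q ≤ r + 1 := SimpleGraph.edist_triangle.trans (add_le_add hp h)
    have h2 : A.gaifman.edist x y ≤ (r + 1) + r :=
      SimpleGraph.edist_triangle.trans
        (add_le_add h1 (by rw [SimpleGraph.edist_comm]; exact hq))
    refine h2.trans ?_
    have : (2 * r + 1 : ℕ) = r + 1 + r := by ring
    rw [this]; push_cast; exact le_rfl
  have farne : ∀ p ∈ A.ball r X, p ∉ A.ball r Y := fun p hp hq => far p hp p hq (by simp)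
  have faradj : ∀ p ∈ A.ball r X, ∀ q ∈ A.ball r Y, ¬ A.gaifman.Adj p q := fun p hp q hq h =>
    far p hp q hq (SimpleGraph.edist_eq_one_iff_adj.2 h).le
  have farrel : ∀ p ∈ A.ball r X, ∀ q ∈ A.ball r Y, ∀ R, ∀ t ∈ A.rel R, p ∈ Set.range t →
      q ∉ Set.range t := fun p hp q hq R t ht hpt hqt =>
    faradj p hp q hq ⟨fun h => farne p hp (h ▸ hq), R, t, ht, hpt, hqt⟩
  have hun : A.ball r (X ∪ Y) = A.ball r X ∪ A.ball r Y := by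
    ext b
    simp only [ball, Set.mem_union, Set.mem_ofPred_eq, or_and_right, exists_or]
  have hmem : ∀ z ∈ (A.dunion A).ball r (Sum.inl '' X ∪ Sum.inr '' Y),
      (∃ p ∈ A.ball r X, z = .inl p) ∨ (∃ q ∈ A.ball r Y, z = .inr q) := by
    intro z hz
    rw [ball_dunion] at hz
    rcases hz with ⟨p, hp, rfl⟩ | ⟨q, hq, rfl⟩
    · exact Or.inl ⟨p, hp, rfl⟩
    · exact Or.inr ⟨q, hq, rfl⟩
  -- The isomorphism forgets the copy; it is injective because the two balls are disjoint.
  let g : (A.dunion A).ball r (Sum.inl '' X ∪ Sum.inr '' Y) → A.ball r (X ∪ Y) := fun z =>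
    ⟨Sum.elim id id (z : V ⊕ V), by
      rw [hun]
      rcases hmem z z.2 with ⟨p, hp, h⟩ | ⟨q, hq, h⟩
      · rw [h]; exact Or.inl hp
      · rw [h]; exact Or.inr hq⟩
  have hg : Function.Bijective g := by
    constructor
    · intro z z' h
      have h' : Sum.elim id id (z : V ⊕ V) = Sum.elim id id (z' : V ⊕ V) := congrArg Subtype.val h
      apply Subtype.ext
      rcases hmem z z.2 with ⟨p, hp, h1⟩ | ⟨p, hp, h1⟩ <;>
        rcases hmem z' z'.2 with ⟨q, hq, h2⟩ | ⟨q, hq, h2⟩ <;> rw [h1, h2] at h' ⊢ <;>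
        simp only [Sum.elim_inl, Sum.elim_inr, id] at h' <;> subst h'
      · rfl
      · exact absurd hq (farne _ hp)
      · exact absurd hp (farne _ hq)
      · rfl
    · rintro ⟨b, hb⟩
      have hb' := hb
      rw [hun] at hb'
      rcases hb' with hb' | hb'
      · exact ⟨⟨.inl b, by rw [ball_dunion]; exact Or.inl ⟨b, hb', rfl⟩⟩, rfl⟩
      · exact ⟨⟨.inr b, by rw [ball_dunion]; exact Or.inr ⟨b, hb', rfl⟩⟩, rfl⟩
  have split : ∀ {n : ℕ} (t : Fin n → (A.dunion A).ball r (Sum.inl '' X ∪ Sum.inr '' Y)),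
      (∃ a : Fin n → V, (fun i => (t i : V ⊕ V)) = Sum.inl ∘ a) ∨
      (∃ b : Fin n → V, (fun i => (t i : V ⊕ V)) = Sum.inr ∘ b) ∨
      ∃ i j, ∃ p ∈ A.ball r X, ∃ q ∈ A.ball r Y,
        (t i : V ⊕ V) = .inl p ∧ (t j : V ⊕ V) = .inr q := by
    intro n t
    by_cases h1 : ∃ i, ∃ p ∈ A.ball r X, (t i : V ⊕ V) = .inl p
    · by_cases h2 : ∃ j, ∃ q ∈ A.ball r Y, (t j : V ⊕ V) = .inr q
      · obtain ⟨i, p, hp, hi⟩ := h1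
        obtain ⟨j, q, hq, hj⟩ := h2
        exact Or.inr (Or.inr ⟨i, j, p, hp, q, hq, hi, hj⟩)
      · have : ∀ i, ∃ p, (t i : V ⊕ V) = .inl p := fun i => by
          rcases hmem _ (t i).2 with ⟨p, hp, h⟩ | ⟨q, hq, h⟩
          · exact ⟨p, h⟩
          · exact absurd ⟨i, q, hq, h⟩ h2
        choose a ha using this
        exact Or.inl ⟨a, funext ha⟩
    · have : ∀ i, ∃ p, (t i : V ⊕ V) = .inr p := fun i => by
        rcases hmem _ (t i).2 with ⟨p, hp, h⟩ | ⟨q, hq, h⟩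
        · exact absurd ⟨i, p, hp, h⟩ h1
        · exact ⟨q, h⟩
      choose a ha using this
      exact Or.inr (Or.inl ⟨a, funext ha⟩)
  have hval : ∀ {n : ℕ} (t : Fin n → (A.dunion A).ball r (Sum.inl '' X ∪ Sum.inr '' Y)),
      (fun i => (((Equiv.ofBijective g hg) ∘ t) i : V)) =
        Sum.elim id id ∘ (fun i => (t i : V ⊕ V)) := fun t => rfl
  refine ⟨Equiv.ofBijective g hg, fun z => rfl, ?_, ?_⟩
  · intro R t
    simp only [induce, Set.mem_ofPred_eq]
    rw [hval]
    rcases split t with ⟨a, ha⟩ | ⟨b, hb⟩ | ⟨i, j, p, hp, q, hq, hi, hj⟩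
    · rw [ha]
      have e1 : (Sum.elim id id : V ⊕ V → V) ∘ Sum.inl ∘ a = a := rfl
      rw [e1]
      constructor
      · rintro (⟨a', ha', h⟩ | ⟨a', ha', h⟩)
        · rwa [Sum.inl_injective.comp_left h]
        -- A tuple in the image of both copies has no entries. This occurs for relations of arity
        -- `0`, where the two tuples agree vacuously.
        · have : ∀ i, False := fun i => by simpa using congrFun h i
          have : a = a' := funext fun i => (this i).elim
          rwa [this]
      · exact fun h => Or.inl ⟨a, h, rfl⟩
    · rw [hb]
      have e1 : (Sum.elim id id : V ⊕ V → V) ∘ Sum.inr ∘ b = b := rfl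
      rw [e1]
      constructor
      · rintro (⟨a', ha', h⟩ | ⟨a', ha', h⟩)
        · have : ∀ i, False := fun i => by simpa using congrFun h i
          have : b = a' := funext fun i => (this i).elim
          rwa [this]
        · rwa [Sum.inr_injective.comp_left h]
      · exact fun h => Or.inr ⟨b, h, rfl⟩
    · constructor
      · rintro (⟨a', -, h⟩ | ⟨a', -, h⟩)
        · have := congrFun h j
          simp only [hj] at this
          simp at this
        · have := congrFun h i
          simp only [hi] at this
          simp at this
      · intro h
        exact absurd ⟨j, by simp [hj]⟩
          (farrel p hp q hq R _ h ⟨i, by simp [hi]⟩)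
  · intro w t
    simp only [induce]
    rw [hval]
    rcases split t with ⟨a, ha⟩ | ⟨b, hb⟩ | ⟨i, j, p, hp, q, hq, hi, hj⟩
    · rw [ha, dunion_wt_inl]; rfl
    · rw [hb, dunion_wt_inr]; rfl
    · rw [dunion_wt_mixed]
      -- A mixed tuple has weight `0` in the union. A nonzero weight in `A` would need arity one, a
      -- constant tuple, or a relation tuple that covers it, and a mixed tuple allows none of these.
      · by_contra hne
        rcases hA w _ (Ne.symm hne) with h | h | ⟨R, s, hs, hsub⟩
        · have : i = j := by apply Fin.ext; omega
          subst this
          rw [hi] at hj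
          simp at hj
        · have := h i j
          simp only [Function.comp_apply, hi, hj, Sum.elim_inl, Sum.elim_inr, id] at this
          exact farne p hp (this ▸ hq)
        · exact farrel p hp q hq R s hs (hsub ⟨i, by simp [hi]⟩) (hsub ⟨j, by simp [hj]⟩)
      · rintro ⟨a, ha⟩
        have := congrFun ha j
        simp only [hj] at this
        simp at this
      · rintro ⟨a, ha⟩
        have := congrFun ha i
        simp only [hi] at this
        simp at this

end WStr

/-! ### Local formulas and assignments -/

namespace WLogic

variable {S : WeightColl} {σ : Sig} {W : WSig S} {V V' : Type}

/-- A local formula with free variables has the same truth value at assignments with isomorphic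
neighbourhoods. -/
theorem IsLocal.sat_iff {L : WLogic.{u} σ W} {r : ℕ} {φ : L.Formula} (hφ : L.IsLocal r φ)
    (hfree : (L.free φ).Nonempty) [Finite V] [Finite V'] {A : WStr σ W V} {B : WStr σ W V'}
    (hA : A.IsWeighted) (hB : B.IsWeighted) {β : ℕ → V} {γ : ℕ → V'}
    {X : Set V} {Y : Set V'} (hX : X = β '' (L.free φ : Set ℕ)) (hY : Y = γ '' (L.free φ : Set ℕ))
    (e : A.ball r X ≃ B.ball r Y)
    (he : WStr.IsIso e (A.induce _) (B.induce _))
    (hval : ∀ x ∈ L.free φ, ∀ h : β x ∈ A.ball r X, (e ⟨β x, h⟩ : V') = γ x) :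
    L.Sat A β φ ↔ L.Sat B γ φ := by
  classical
  subst hX hY
  obtain ⟨x₀, hx₀⟩ := hfree
  have hm : ∀ x ∈ L.free φ, β x ∈ A.ball r (β '' (L.free φ : Set ℕ)) := fun x hx =>
    A.subset_ball r _ ⟨x, hx, rfl⟩
  -- `β` may leave the ball at variables that are not free; these get the value of some free
  -- variable, which is why there must be one.
  let β' : ℕ → A.ball r (β '' (L.free φ : Set ℕ)) := fun x =>
    if h : x ∈ L.free φ then ⟨β x, hm x h⟩ else ⟨β x₀, hm x₀ hx₀⟩
  have hβ' : ∀ x, ∀ h : x ∈ L.free φ, β' x = ⟨β x, hm x h⟩ := fun x hx => dif_pos hx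
  rw [hφ A hA β β' fun x hx => by rw [hβ' x hx]]
  rw [hφ B hB γ (e ∘ β') fun x hx => by rw [Function.comp_apply, hβ' x hx, hval x hx]]
  exact L.sat_iso e _ _ β' φ he

/-- Two groups of variables whose values are far apart may be interpreted in two disjoint copies
of the structure. -/
theorem IsLocal.sat_dunion_iff {L : WLogic.{u} σ W} {r : ℕ} {φ : L.Formula} (hφ : L.IsLocal r φ)
    [Finite V] {A : WStr σ W V} (hA : A.IsWeighted) (β : ℕ → V) (γ : ℕ → V ⊕ V) (Z Z' : Finset ℕ)
    (hZ : Z.Nonempty) (hZZ' : Z ∪ Z' = L.free φ)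
    (hγ : ∀ z ∈ Z, γ z = .inl (β z)) (hγ' : ∀ z ∈ Z', γ z = .inr (β z))
    (hfar : ∀ z ∈ Z, ∀ z' ∈ Z', ¬ A.gaifman.edist (β z) (β z') ≤ ((2 * r + 1 : ℕ) : ℕ∞)) :
    L.Sat (A.dunion A) γ φ ↔ L.Sat A β φ := by
  obtain ⟨e, he, hiso⟩ := A.exists_iso_ball_dunion hA r (β '' (Z : Set ℕ)) (β '' (Z' : Set ℕ)) (by
    rintro _ ⟨z, hz, rfl⟩ _ ⟨z', hz', rfl⟩
    exact hfar z hz z' hz')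
  refine hφ.sat_iff ?_ (hA.dunion hA) hA ?_ ?_ e hiso ?_
  · rw [← hZZ']; exact hZ.mono Finset.subset_union_left
  · rw [← hZZ', Finset.coe_union, Set.image_union, Set.image_image, Set.image_image,
      Set.image_congr fun z hz => hγ z hz, Set.image_congr fun z hz => hγ' z hz]
  · rw [← hZZ', Finset.coe_union, Set.image_union]
  · intro x hx h
    rw [he]
    rw [← hZZ', Finset.mem_union] at hx
    rcases hx with hx | hx
    · simp [hγ x hx]
    · simp [hγ' x hx]

/-- The assignment of the values `a`, `v` to the variables `0,…,k-1,k,…,k+ℓ-1`, and of `x₀` to the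
other variables. -/
def assignment {k ℓ : ℕ} (a : Fin k → V) (v : Fin ℓ → V) (x₀ : V) (x : ℕ) : V :=
  if h : x < k + ℓ then Fin.append a v ⟨x, h⟩ else x₀

theorem assignment_left {k ℓ : ℕ} (a : Fin k → V) (v : Fin ℓ → V) (x₀ : V) (i : Fin k) :
    assignment a v x₀ i = a i := by
  have h : (i : ℕ) < k + ℓ := by omega
  rw [assignment, dif_pos h]
  exact Fin.append_left a v i

theorem assignment_right {k ℓ : ℕ} (a : Fin k → V) (v : Fin ℓ → V) (x₀ : V) (j : Fin ℓ) :
    assignment a v x₀ (k + j) = v j := by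
  have h : (k + j : ℕ) < k + ℓ := by omega
  rw [assignment, dif_pos h]
  exact Fin.append_right a v j

/-- `Holds` quantifies over all assignments that extend the two tuples. They agree on the variables
below `k + ℓ`, so one of them decides. -/
theorem holds_iff_sat {L : WLogic.{u} σ W} [Finite V] {A : WStr σ W V} {φ : L.Formula} {k ℓ : ℕ}
    (hφ : L.free φ ⊆ Finset.range (k + ℓ)) (a : Fin k → V) (v : Fin ℓ → V) (x₀ : V) :
    L.Holds A φ a v ↔ L.Sat A (assignment a v x₀) φ := by
  constructor
  · intro h
    exact h _ (assignment_left a v x₀) (assignment_right a v x₀)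
  · intro h β hk hℓ
    refine (L.sat_congr A _ _ φ fun x hx => ?_).1 h
    have hx' := Finset.mem_range.1 (hφ hx)
    rcases Nat.lt_or_ge x k with hlt | hge
    · exact (assignment_left a v x₀ ⟨x, hlt⟩).trans (hk ⟨x, hlt⟩).symm
    · obtain ⟨j, rfl⟩ := Nat.exists_eq_add_of_le hge
      have hj : j < ℓ := by omega
      exact (assignment_right a v x₀ ⟨j, hj⟩).trans (hℓ ⟨j, hj⟩).symm

end WLogic

/-! ### Moving parameters close to the training elements -/

/-- The parameters that are linked to `X` by steps of length at most `s`. -/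
theorem WStr.exists_near_params {S : WeightColl} {σ : Sig} {W : WSig S} {V : Type}
    (A : WStr σ W V) (s ℓ : ℕ) (X : Set V) (v : Fin ℓ → V) :
    ∃ J : Finset (Fin ℓ), (∀ j ∈ J, v j ∈ A.ball (s * ℓ) X) ∧
      (∀ j ∉ J, ∀ x ∈ X, ¬ A.gaifman.edist x (v j) ≤ s) ∧
      (∀ j ∉ J, ∀ i ∈ J, ¬ A.gaifman.edist (v i) (v j) ≤ s) := by
  classical
  -- Letting the radius grow with the cardinality replaces chains by a maximality argument: a
  -- parameter within `s` of `X` or of a chosen one lies within `s * (J.card + 1)` of `X` and could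
  -- be added to `J`. Since `J.card ≤ ℓ`, the radius never exceeds `s * ℓ`.
  let good : Finset (Fin ℓ) → Prop := fun J => ∀ j ∈ J, v j ∈ A.ball (s * J.card) X
  obtain ⟨J, hJ, hmax⟩ := Finset.exists_max_image (Finset.univ.filter good) Finset.card
    ⟨∅, by simp [good]⟩
  simp only [Finset.mem_filter, Finset.mem_univ, true_and] at hJ hmax
  have key : ∀ j ∉ J, v j ∉ A.ball (s * (J.card + 1)) X := by
    intro j hj hmem
    have := hmax (insert j J) (by
      intro i hi
      rw [Finset.card_insert_of_notMem hj]
      rcases Finset.mem_insert.1 hi with rfl | hi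
      · exact hmem
      · exact A.ball_mono (Nat.mul_le_mul_left s (Nat.le_succ _)) X (hJ i hi))
    rw [Finset.card_insert_of_notMem hj] at this
    omega
  refine ⟨J, fun j hj => A.ball_mono (Nat.mul_le_mul_left s (by simpa using J.card_le_univ)) X
    (hJ j hj), fun j hj x hx h => key j hj ?_, fun j hj i hi h => key j hj ?_⟩
  · rw [Nat.mul_succ]
    exact A.ball_ball _ _ X (A.subset_ball _ X hx) h
  · rw [Nat.mul_succ]
    exact A.ball_ball _ _ X (hJ i hi) h

namespace HasLocalNormalForms

variable {S : WeightColl} {σ σs : Sig} {W : WSig S} {V : Type}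
  {L : WLogic.{u} σ W} {Ls : WLogic.{v} σs W} {k ℓ r : ℕ} {Φ : Set L.Formula}
  {Φs : Set Ls.Formula}

theorem exists_true (h : HasLocalNormalForms k ℓ r Φ Φs) {φ : Ls.Formula} (hφ : φ ∈ Φs) :
    ∃ ψ ∈ Φs, ∀ {V : Type} [Finite V] (A : WStr σs W V), A.IsWeighted →
      ∀ β : ℕ → V, Ls.Sat A β ψ := by
  obtain ⟨ψ, hψ, h1⟩ := h.neg φ hφ
  obtain ⟨χ, hχ, h2⟩ := h.or φ hφ ψ hψ
  exact ⟨χ, hχ, fun A hA β => by rw [h2 A hA, h1 A hA]; exact em _⟩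

theorem exists_false (h : HasLocalNormalForms k ℓ r Φ Φs) {φ : Ls.Formula} (hφ : φ ∈ Φs) :
    ∃ ψ ∈ Φs, ∀ {V : Type} [Finite V] (A : WStr σs W V), A.IsWeighted →
      ∀ β : ℕ → V, ¬ Ls.Sat A β ψ := by
  obtain ⟨ψ, hψ, h1⟩ := h.exists_true hφ
  obtain ⟨χ, hχ, h2⟩ := h.neg ψ hψ
  exact ⟨χ, hχ, fun A hA β => by rw [h2 A hA, not_not]; exact h1 A hA β⟩

/-- The member `φ` serves the empty disjunction: from it a contradiction is built by negation and
disjunction. -/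
theorem exists_disjunction (h : HasLocalNormalForms k ℓ r Φ Φs) {φ : Ls.Formula} (hφ : φ ∈ Φs)
    {D : Set Ls.Formula} (hD : D.Finite) (hDΦ : D ⊆ Φs) :
    ∃ ψ ∈ Φs, ∀ {V : Type} [Finite V] (A : WStr σs W V), A.IsWeighted →
      ∀ β : ℕ → V, Ls.Sat A β ψ ↔ ∃ χ ∈ D, Ls.Sat A β χ := by
  induction D, hD using Set.Finite.induction_on with
  | empty =>
    obtain ⟨ψ, hψ, h1⟩ := h.exists_false hφ
    exact ⟨ψ, hψ, fun A hA β => by simp [h1 A hA β]⟩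
  | @insert χ D _ _ ih =>
    obtain ⟨ψ, hψ, h1⟩ := ih fun x hx => hDΦ (Set.mem_insert_of_mem _ hx)
    obtain ⟨ξ, hξ, h2⟩ := h.or χ (hDΦ (Set.mem_insert _ _)) ψ hψ
    exact ⟨ξ, hξ, fun A hA β => by rw [h2 A hA, h1 A hA]; simp⟩

/-- On tuples from `X`, parameters may be replaced by parameters in a neighbourhood of `X`. -/
theorem exists_near_hypothesis (h : HasLocalNormalForms k ℓ r Φ Φs) [Finite V]
    {A : WStr σs W V} (hA : A.IsWeighted) {X : Set V} (hX : ℓ = 0 ∨ X.Nonempty)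
    {φ : Ls.Formula} (hφ : φ ∈ Φs) (v : Fin ℓ → V) :
    ∃ ψ ∈ Φs, ∃ v' : Fin ℓ → V, (∀ j, v' j ∈ A.ball ((2 * r + 1) * ℓ) X) ∧
      ∀ a : Fin k → V, (∀ i, a i ∈ X) → (Ls.Holds A φ a v ↔ Ls.Holds A ψ a v') := by
  classical
  rcases hX with rfl | ⟨x₀, hx₀⟩
  · exact ⟨φ, hφ, v, fun j => j.elim0, fun _ _ => Iff.rfl⟩
  obtain ⟨J, hJ, hJX, hJJ⟩ := A.exists_near_params (2 * r + 1) ℓ X v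
  let v' : Fin ℓ → V := fun j => if j ∈ J then v j else x₀
  have hv' : ∀ j, v' j ∈ A.ball ((2 * r + 1) * ℓ) X := by
    intro j
    by_cases hj : j ∈ J
    · simpa [v', hj] using hJ j hj
    · simpa [v', hj] using A.subset_ball _ X hx₀
  -- Only the variables of far parameters fail `near`; it holds vacuously for the variables of the
  -- example.
  let near : ℕ → Prop := fun x => ∀ j : Fin ℓ, x = k + j → j ∈ J
  have hnear : ∀ x < k + ℓ, near x → (∃ i : Fin k, x = i) ∨ ∃ j ∈ J, x = k + (j : Fin ℓ) := by
    intro x hx hn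
    rcases Nat.lt_or_ge x k with hlt | hge
    · exact Or.inl ⟨⟨x, hlt⟩, rfl⟩
    · obtain ⟨j, rfl⟩ := Nat.exists_eq_add_of_le hge
      have hj : j < ℓ := by omega
      exact Or.inr ⟨⟨j, hj⟩, hn ⟨j, hj⟩ rfl, rfl⟩
  have hfarvar : ∀ x, ¬ near x → ∃ j ∉ J, x = k + (j : Fin ℓ) := by
    intro x hx
    simp only [near, not_forall] at hx
    obtain ⟨j, rfl, hj⟩ := hx
    exact ⟨j, hj, rfl⟩
  have hagree : ∀ (a : Fin k → V) (x : ℕ), x < k + ℓ → near x →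
      WLogic.assignment a v x₀ x = WLogic.assignment a v' x₀ x := by
    intro a x hx hn
    rcases hnear x hx hn with ⟨i, rfl⟩ | ⟨j, hj, rfl⟩
    · rw [WLogic.assignment_left, WLogic.assignment_left]
    · rw [WLogic.assignment_right, WLogic.assignment_right]
      simp [v', hj]
  have hagree' : ∀ (a a' : Fin k → V) (x : ℕ), ¬ near x →
      WLogic.assignment a v x₀ x = WLogic.assignment a' v x₀ x := by
    intro a a' x hn
    obtain ⟨j, hj, rfl⟩ := hfarvar x hn
    rw [WLogic.assignment_right, WLogic.assignment_right]
  have hfreeφ := h.free_subset_star φ hφ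
  set Z := (Ls.free φ).filter near with hZdef
  set Z' := (Ls.free φ).filter (fun x => ¬ near x) with hZ'def
  have hZZ' : Z ∪ Z' = Ls.free φ := Finset.filter_union_filter_not_eq _ _
  have hdisj : Disjoint Z Z' := Finset.disjoint_filter_filter_not _ _ _
  have hZmem : ∀ z ∈ Z, z < k + ℓ ∧ near z := fun z hz =>
    ⟨Finset.mem_range.1 (hfreeφ (Finset.mem_filter.1 hz).1), (Finset.mem_filter.1 hz).2⟩
  have hZ'mem : ∀ z ∈ Z', ¬ near z := fun z hz => (Finset.mem_filter.1 hz).2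
  rcases Z'.eq_empty_or_nonempty with hZ' | hZ'
  · refine ⟨φ, hφ, v', hv', fun a _ => ?_⟩
    rw [WLogic.holds_iff_sat hfreeφ a v x₀, WLogic.holds_iff_sat hfreeφ a v' x₀]
    refine Ls.sat_congr A _ _ φ fun x hx => ?_
    rw [← hZZ', hZ', Finset.union_empty] at hx
    exact hagree a x (hZmem x hx).1 (hZmem x hx).2
  rcases Z.eq_empty_or_nonempty with hZ | hZ
  -- Decompositions exist only for two non-empty parts. If all free variables are far, then `φ` does
  -- not depend on the example and is replaced by a constant truth value.
  · have hconst : ∀ a a' : Fin k → V, Ls.Holds A φ a v → Ls.Holds A φ a' v := by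
      intro a a' ha
      rw [WLogic.holds_iff_sat hfreeφ _ v x₀] at ha ⊢
      refine (Ls.sat_congr A _ _ φ fun x hx => ?_).1 ha
      rw [← hZZ', hZ, Finset.empty_union] at hx
      exact hagree' a a' x (hZ'mem x hx)
    by_cases ht : Ls.Holds A φ (fun _ : Fin k => x₀) v
    · obtain ⟨ψ, hψ, h1⟩ := h.exists_true hφ
      exact ⟨ψ, hψ, v', hv', fun a _ => ⟨fun _ β _ _ => h1 A hA β, fun _ => hconst _ a ht⟩⟩
    · obtain ⟨ψ, hψ, h1⟩ := h.exists_false hφ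
      refine ⟨ψ, hψ, v', hv', fun a _ => ⟨fun h' => absurd (hconst a _ h') ht, fun h' => ?_⟩⟩
      rw [WLogic.holds_iff_sat (h.free_subset_star ψ hψ) _ v' x₀] at h'
      exact absurd h' (h1 A hA _)
  obtain ⟨Δ, hΔfin, -, hΔ, hsat⟩ := h.fv φ hφ Z Z' hZ hZ' hdisj hZZ'
  -- The far halves have only far variables, so their truth does not depend on the example. The
  -- tuple constantly `x₀` is a stand-in for it, and one set `D` works for all examples.
  let D : Set Ls.Formula := Prod.fst '' {p | p ∈ Δ ∧ Ls.Sat A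
    (WLogic.assignment (fun _ : Fin k => x₀) v x₀) p.2}
  obtain ⟨ψ, hψ, h1⟩ := h.exists_disjunction hφ (D := D)
    ((hΔfin.subset fun p hp => hp.1).image _) (by rintro _ ⟨p, hp, rfl⟩; exact (hΔ p hp.1).1)
  refine ⟨ψ, hψ, v', hv', fun a ha => ?_⟩
  rw [WLogic.holds_iff_sat hfreeφ a v x₀,
    WLogic.holds_iff_sat (h.free_subset_star ψ hψ) a v' x₀, h1 A hA]
  let γ : ℕ → V ⊕ V := fun x => if x ∈ Z then .inl (WLogic.assignment a v x₀ x)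
    else .inr (WLogic.assignment a v x₀ x)
  have hγ : ∀ z ∈ Z, γ z = .inl (WLogic.assignment a v x₀ z) := fun z hz => if_pos hz
  have hγ' : ∀ z ∈ Z', γ z = .inr (WLogic.assignment a v x₀ z) := fun z hz =>
    if_neg (Finset.disjoint_right.1 hdisj hz)
  -- Both copies are the whole of `A`, so the near halves are evaluated in `A` itself afterwards.
  -- The separation uses that the example has its entries in `X`.
  rw [← WLogic.IsLocal.sat_dunion_iff (h.isLocal φ hφ) hA (WLogic.assignment a v x₀) γ Z Z' hZ hZZ' hγ hγ' (by
    intro z hz z' hz'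
    obtain ⟨j, hj, rfl⟩ := hfarvar z' (hZ'mem z' hz')
    rw [WLogic.assignment_right]
    rcases hnear z (hZmem z hz).1 (hZmem z hz).2 with ⟨i, rfl⟩ | ⟨i, hi, rfl⟩
    · rw [WLogic.assignment_left]
      exact hJX j hj _ (ha i)
    · rw [WLogic.assignment_right]
      exact hJJ j hj i hi)]
  rw [hsat A A hA hA _ _ γ hγ hγ']
  constructor
  · rintro ⟨p, hp, hp1, hp2⟩
    refine ⟨p.1, ⟨p, ⟨hp, ?_⟩, rfl⟩, ?_⟩
    · exact (Ls.sat_congr A _ _ p.2 fun x hx =>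
        hagree' a _ x (hZ'mem x ((hΔ p hp).2.2.2 hx))).1 hp2
    · exact (Ls.sat_congr A _ _ p.1 fun x hx =>
        hagree a x (hZmem x ((hΔ p hp).2.2.1 hx)).1 (hZmem x ((hΔ p hp).2.2.1 hx)).2).1 hp1
  · rintro ⟨_, ⟨p, ⟨hp, hp2⟩, rfl⟩, hp1⟩
    refine ⟨p, hp, ?_, ?_⟩
    · exact (Ls.sat_congr A _ _ p.1 fun x hx =>
        hagree a x (hZmem x ((hΔ p hp).2.2.1 hx)).1 (hZmem x ((hΔ p hp).2.2.1 hx)).2).2 hp1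
    · exact (Ls.sat_congr A _ _ p.2 fun x hx =>
        hagree' a _ x (hZ'mem x ((hΔ p hp).2.2.2 hx))).2 hp2

end HasLocalNormalForms


/-! ### Programs with time bounds -/

noncomputable section

section Programs

variable {S : WeightColl} {σ : Sig} {W : WSig S} {P : PredColl S} {V : Type} {A : WStr σ W V}

/-- Started in the store `s`, the program `c` halts within time `B` in the store `s'`. -/
def ExecIn (acc : A.Access) (c : Prog σ W P) (s s' : ℕ → Val S V) (B : ℕ) : Prop :=
  ∃ t ≤ B, Exec acc c s s' t

/-- On input `x`, the program `c` halts within time `B` with output `y`. -/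
def Prog.RunsIn (c : Prog σ W P) (acc : A.Access) (x y : Val S V) (B : ℕ) : Prop :=
  ∃ t ≤ B, c.Runs acc x y t

variable {acc : A.Access} {c c' : Prog σ W P} {s s' s'' : ℕ → Val S V} {B B' : ℕ}

theorem ExecIn.mono (h : ExecIn acc c s s' B) (hB : B ≤ B') : ExecIn acc c s s' B' :=
  let ⟨t, ht, h⟩ := h
  ⟨t, ht.trans hB, h⟩

theorem Prog.RunsIn.mono {x y : Val S V} (h : c.RunsIn acc x y B) (hB : B ≤ B') :
    c.RunsIn acc x y B' :=
  let ⟨t, ht, h⟩ := h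
  ⟨t, ht.trans hB, h⟩

theorem ExecIn.assign (x : ℕ) (e : PExp σ W P) {y : Val S V} (hy : e.val acc s = y)
    (hB : e.cost acc s + 1 ≤ B) : ExecIn acc (.assign x e) s (Function.update s x y) B :=
  ⟨_, hB, hy ▸ Exec.assign x e s⟩

theorem ExecIn.seq (h : ExecIn acc c s s' B) (h' : ExecIn acc c' s' s'' B') :
    ExecIn acc (.seq c c') s s'' (B + B') :=
  let ⟨_, ht, h⟩ := h
  let ⟨_, ht', h'⟩ := h'
  ⟨_, Nat.add_le_add ht ht', h.seq h'⟩

theorem ExecIn.call (x : ℕ) {e : PExp σ W P} {z y : Val S V} (hz : e.val acc s = z)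
    (h : c.RunsIn acc z y B) (hB : e.cost acc s + 1 + B ≤ B') :
    ExecIn acc (.call x c e) s (Function.update s x y) B' := by
  subst hz
  obtain ⟨t, ht, s', h, rfl⟩ := h
  exact ⟨_, le_trans (Nat.add_le_add_left ht _) hB, .call h⟩

theorem ExecIn.ite {e : PExp σ W P} (h : e.val acc s ≠ .nil → ExecIn acc c s s' B)
    (h' : e.val acc s = .nil → ExecIn acc c' s s' B) (hB : e.cost acc s + 1 + B ≤ B') :
    ExecIn acc (.ite e c c') s s' B' := by
  by_cases he : e.val acc s = .nil
  · obtain ⟨t, ht, h'⟩ := h' he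
    exact ⟨_, le_trans (Nat.add_le_add_left ht _) hB, .ite_false he h'⟩
  · obtain ⟨t, ht, h⟩ := h he
    exact ⟨_, le_trans (Nat.add_le_add_left ht _) hB, .ite_true he h⟩

theorem ExecIn.runsIn {x y : Val S V} (h : ExecIn acc c (initStore x) s' B) (hy : s' 0 = y) :
    c.RunsIn acc x y B :=
  let ⟨t, ht, h⟩ := h
  ⟨t, ht, s', h, hy⟩

/-- On input `(e, (b, l))`, fold the list `l` from the left by `c`, starting with `b`; in every step
`c` gets the value `e`, the current result and the current element of `l`. -/
def Prog.fold (c : Prog σ W P) : Prog σ W P :=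
  .seq (.assign 1 (.hd (.tl (.var 0)))) <|
  .seq (.assign 2 (.tl (.tl (.var 0)))) <|
  .seq (.loop (.var 2)
    (.seq (.call 1 c (.cons (.hd (.var 0)) (.cons (.var 1) (.hd (.var 2)))))
      (.assign 2 (.tl (.var 2)))))
  (.assign 0 (.var 1))

/-- Variable `1` holds the accumulator and variable `2` the rest of the list. Copying a value costs
one unit whatever its size, so one bound `B` can serve all accumulators, however long; `13` is the
overhead of the loop test, the call and the step to the tail. The environment travels with the input
because a subroutine has its own variables. -/
theorem Prog.fold_runsIn {α β : Type} (env : Val S V) (enc : α → Val S V) (encS : β → Val S V)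
    (g : β → α → β) (l : List α) (b : β)
    (h : ∀ b, ∀ a ∈ l, c.RunsIn acc (.cons env (.cons (encS b) (enc a))) (encS (g b a)) B) :
    c.fold.RunsIn acc (.cons env (.cons (encS b) (Val.ofList (l.map enc)))) (encS (l.foldl g b))
      (12 + l.length * (B + 13)) := by
  have hloop : ∀ (l : List α) (b : β) (s : ℕ → Val S V),
      (∀ b, ∀ a ∈ l, c.RunsIn acc (.cons env (.cons (encS b) (enc a))) (encS (g b a)) B) →
      (s 0).hd = env → s 1 = encS b → s 2 = Val.ofList (l.map enc) →
      ∃ s', s' 1 = encS (l.foldl g b) ∧ ExecIn acc (.loop (.var 2)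
        (.seq (.call 1 c (.cons (.hd (.var 0)) (.cons (.var 1) (.hd (.var 2)))))
          (.assign 2 (.tl (.var 2))))) s s' (2 + l.length * (B + 13)) := by
    intro l
    induction l with
    | nil =>
      intro b s _ _ h1 h2
      exact ⟨s, h1, _, by simp [PExp.cost], .loop_done (by simpa [PExp.val, Val.ofList] using h2)⟩
    | cons a l ih =>
      intro b s hc h0 h1 h2
      obtain ⟨t, ht, hbody⟩ :=
        (ExecIn.call (s := s) (B' := B + 8) 1
          (e := .cons (.hd (.var 0)) (.cons (.var 1) (.hd (.var 2))))
          (by simp only [PExp.val]; rw [h0, h1, h2]; rfl)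
          (hc b a (by simp))
          (by simp only [PExp.cost]; omega)).seq
        (ExecIn.assign (B := 3) 2 (.tl (.var 2)) (y := Val.ofList (l.map enc))
          (by simp [PExp.val, h2, Val.ofList, Val.tl]) (by simp [PExp.cost]))
      obtain ⟨s', hs', t', ht', hrest⟩ := ih (g b a)
        (Function.update (Function.update s 1 (encS (g b a))) 2 (Val.ofList (l.map enc)))
        (fun b a ha => hc b a (by simp [ha]))
        (by simpa using h0) (by simp) (by simp)
      refine ⟨s', hs', _, ?_, .loop_step (by simp [PExp.val, h2, Val.ofList]) hbody hrest⟩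
      simp only [PExp.cost, List.length_cons, Nat.add_mul]
      omega
  obtain ⟨s', hs', hl⟩ := hloop l b
    (Function.update (Function.update (initStore (.cons env (.cons (encS b) (Val.ofList (l.map enc)))))
      1 (encS b)) 2 (Val.ofList (l.map enc))) h (by simp [initStore, Val.hd]) (by simp) (by simp)
  refine (((ExecIn.assign (B := 4) 1 _ (by simp [PExp.val, initStore, Val.hd, Val.tl])
    (by simp [PExp.cost])).seq ((ExecIn.assign (B := 4) 2 _
    (by simp [PExp.val, initStore, Val.tl]) (by simp [PExp.cost])).seq
    (hl.seq (ExecIn.assign (B := 2) 0 _ (y := encS (l.foldl g b)) (by simpa [PExp.val] using hs')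
      (by simp [PExp.cost]))))).mono ?_).runsIn (by simp)
  omega

theorem List.foldl_cons_map {α β : Type} (f : α → β) (l : List α) (s : List β) :
    l.foldl (fun s a => f a :: s) s = (l.map f).reverse ++ s := by
  induction l generalizing s with
  | nil => rfl
  | cons a l ih => simp [ih]

theorem List.mem_foldl_append {α β : Type} (f : α → List β) (l : List α) (s : List β) (x : β) :
    x ∈ l.foldl (fun s a => f a ++ s) s ↔ x ∈ s ∨ ∃ a ∈ l, x ∈ f a := by
  induction l generalizing s with
  | nil => simp
  | cons a l ih =>
    simp only [List.foldl_cons, ih, List.mem_append, List.mem_cons, exists_eq_or_imp]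
    generalize (∃ b ∈ l, x ∈ f b) = q
    tauto

theorem List.length_foldl_append_le {α β : Type} (f : α → List β) (K : ℕ) (l : List α)
    (s : List β) (h : ∀ a ∈ l, (f a).length ≤ K) :
    (l.foldl (fun s a => f a ++ s) s).length ≤ s.length + l.length * K := by
  induction l generalizing s with
  | nil => simp
  | cons a l ih =>
    have h1 := ih (f a ++ s) fun b hb => h b (by simp [hb])
    have h2 := h a (by simp)
    simp only [List.foldl_cons, List.length_append, List.length_cons, Nat.add_mul] at h1 ⊢
    omega

/-- A list of elements as a value. -/
def Val.elems (l : List V) : Val S V := Val.ofList (l.map Val.elem)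

theorem Val.tuple_eq_elems {n : ℕ} (a : Fin n → V) :
    (Val.tuple a : Val S V) = Val.elems (List.ofFn a) := by
  rw [Val.tuple, Val.elems, List.map_ofFn]
  rfl

theorem Val.tuple_cons {n : ℕ} (x : V) (a : Fin n → V) :
    (Val.tuple (Fin.cons x a : Fin (n + 1) → V) : Val S V) = .cons (.elem x) (Val.tuple a) := by
  simp [Val.tuple, List.ofFn_succ, Val.ofList]

/-! ### Collecting the neighbourhood of the training elements -/

/-- Push the elements of a list onto another list. -/
def Prog.pushAll : Prog σ W P :=
  .fold (.assign 0 (.cons (.tl (.tl (.var 0))) (.hd (.tl (.var 0)))))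

theorem Prog.pushAll_runsIn (s l : List V) :
    (pushAll : Prog σ W P).RunsIn acc (.cons .nil (.cons (Val.elems s) (Val.elems l)))
      (Val.elems (l.reverse ++ s)) (12 + l.length * 21) := by
  have h := Prog.fold_runsIn (acc := acc) (B := 8)
    (c := (.assign 0 (.cons (.tl (.tl (.var 0))) (.hd (.tl (.var 0)))) : Prog σ W P))
    .nil Val.elem Val.elems (fun s a => a :: s) l s (by
      intro s a _
      refine (ExecIn.assign 0 _ rfl (by simp [PExp.cost])).runsIn ?_
      simp [PExp.val, initStore, Val.hd, Val.tl, Val.elems, Val.ofList])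
  have e := List.foldl_cons_map id l s
  simp only [id, List.map_id_fun] at e
  rw [e] at h
  exact h

/-- List the elements of a training sequence. -/
def Prog.collect : Prog σ W P :=
  .fold (.call 0 .pushAll (.cons .nil (.cons (.hd (.tl (.var 0))) (.hd (.tl (.tl (.var 0)))))))

/-- The exact list that the program builds, with reversals and repetitions. Only its members and its
length matter later. -/
def collectList {k : ℕ} (T : List ((Fin k → V) × Bool)) : List V :=
  T.foldl (fun s p => (List.ofFn p.1).reverse ++ s) []

theorem mem_collectList {k : ℕ} (T : List ((Fin k → V) × Bool)) (x : V) :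
    x ∈ collectList T ↔ x ∈ trainingElems T := by
  rw [collectList, List.mem_foldl_append (fun p : (Fin k → V) × Bool => (List.ofFn p.1).reverse)]
  simp only [List.not_mem_nil, false_or, List.mem_reverse, List.mem_ofFn, trainingElems,
    Set.mem_ofPred_eq]

theorem length_collectList_le {k : ℕ} (T : List ((Fin k → V) × Bool)) :
    (collectList T).length ≤ T.length * k := by
  have := List.length_foldl_append_le (fun p : (Fin k → V) × Bool => (List.ofFn p.1).reverse) k T []
    (by simp)
  simpa [collectList] using this

theorem Prog.collect_runsIn {k : ℕ} (T : List ((Fin k → V) × Bool)) :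
    (collect : Prog σ W P).RunsIn acc (.cons .nil (.cons .nil (Val.training T)))
      (Val.elems (collectList T)) (12 + T.length * (k * 21 + 36)) := by
  refine (Prog.fold_runsIn (B := k * 21 + 23) .nil _ Val.elems
    (fun s p => (List.ofFn p.1).reverse ++ s) T [] ?_)
  intro s p _
  refine (ExecIn.call 0 (z := .cons .nil (.cons (Val.elems s) (Val.elems (List.ofFn p.1)))) ?_
    (pushAll_runsIn s (List.ofFn p.1)) ?_).runsIn (by simp)
  · simp [PExp.val, initStore, Val.hd, Val.tl, Val.tuple_eq_elems]
  · simp only [PExp.cost, List.length_ofFn]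
    omega

/-- Add the neighbours of the elements of a list to the list. -/
def Prog.expand : Prog σ W P :=
  .fold (.call 0 .pushAll (.cons .nil (.cons (.cons (.tl (.tl (.var 0))) (.hd (.tl (.var 0))))
    (.nbrs (.tl (.tl (.var 0)))))))

/-- Repetitions are kept, which avoids comparing elements; a round still multiplies the length by at
most the degree plus one. -/
def expandList (acc : A.Access) (l : List V) : List V :=
  l.foldl (fun s a => ((acc.nbrs a).reverse ++ [a]) ++ s) []

theorem mem_expandList (l : List V) (x : V) :
    x ∈ expandList acc l ↔ x ∈ l ∨ ∃ a ∈ l, A.gaifman.Adj a x := by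
  rw [expandList, List.mem_foldl_append (fun a => (acc.nbrs a).reverse ++ [a])]
  simp only [List.not_mem_nil, false_or, List.mem_append, List.mem_reverse, List.mem_singleton,
    acc.mem_nbrs]
  constructor
  · rintro ⟨a, ha, h | rfl⟩
    · exact Or.inr ⟨a, ha, h⟩
    · exact Or.inl ha
  · rintro (h | ⟨a, ha, h⟩)
    · exact ⟨x, h, Or.inr rfl⟩
    · exact ⟨a, ha, Or.inl h⟩

theorem mem_iterate_expandList (l : List V) (n : ℕ) (x : V) :
    x ∈ (expandList acc)^[n] l ↔ x ∈ A.ball n {a | a ∈ l} := by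
  induction n generalizing x with
  | zero => simp [WStr.ball_zero]
  | succ n ih =>
    rw [Function.iterate_succ_apply', mem_expandList, WStr.mem_ball_succ, ih]
    simp only [ih]

theorem length_nbrs_le [Finite V] (acc : A.Access) (a : V) :
    (acc.nbrs a).length ≤ A.degree := by
  classical
  have h : (A.gaifman.neighborSet a).ncard = (acc.nbrs a).length := by
    rw [← List.toFinset_card_of_nodup (acc.nodup a), ← Set.ncard_coe_finset]
    congr 1
    ext b
    simp [acc.mem_nbrs]
  rw [← h]
  exact le_ciSup (f := fun v => (A.gaifman.neighborSet v).ncard) (Set.finite_range _).bddAbove a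

theorem length_iterate_expandList_le [Finite V] (l : List V) (n : ℕ) :
    ((expandList acc)^[n] l).length ≤ l.length * (A.degree + 1) ^ n := by
  induction n with
  | zero => simp
  | succ n ih =>
    rw [Function.iterate_succ_apply', pow_succ, ← mul_assoc]
    refine le_trans ?_ (Nat.mul_le_mul_right _ ih)
    have := List.length_foldl_append_le (fun a => (acc.nbrs a).reverse ++ [a]) (A.degree + 1)
      ((expandList acc)^[n] l) [] (fun a _ => by simpa using length_nbrs_le acc a)
    simpa [expandList] using this

theorem Prog.expand_runsIn [Finite V] (l : List V) :
    (expand : Prog σ W P).RunsIn acc (.cons .nil (.cons .nil (Val.elems l)))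
      (Val.elems (expandList acc l))
      (12 + l.length * (A.degree * 21 + (A.degree + 1) * nameLen V + 40)) := by
  refine (Prog.fold_runsIn (B := A.degree * 21 + (A.degree + 1) * nameLen V + 27) .nil _ Val.elems
    (fun s a => ((acc.nbrs a).reverse ++ [a]) ++ s) l [] ?_)
  intro s a _
  refine (ExecIn.call 0 (z := .cons .nil (.cons (Val.elems (a :: s)) (Val.elems (acc.nbrs a)))) ?_
    (pushAll_runsIn (a :: s) (acc.nbrs a)) ?_).runsIn (by simp)
  · simp [PExp.val, initStore, Val.hd, Val.tl, Val.elems, Val.ofList]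
  · have h := length_nbrs_le acc a
    have h' := Nat.mul_le_mul_right (nameLen V) (Nat.add_le_add_right h 1)
    have hv : (PExp.tl (.tl (.var 0)) : PExp σ W P).val acc
        (initStore (.cons .nil (.cons (Val.elems s) (.elem a)))) = .elem a := by
      simp [PExp.val, initStore, Val.tl]
    have hn : (PExp.nbrs (.tl (.tl (.var 0))) : PExp σ W P).cost acc
        (initStore (.cons .nil (.cons (Val.elems s) (.elem a)))) =
          4 + ((acc.nbrs a).length + 1) * nameLen V := by
      rw [PExp.cost, hv]
      rfl
    rw [PExp.cost, PExp.cost, PExp.cost, hn]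
    simp only [PExp.cost]
    omega

/-- The number of rounds is a constant of the problem, so the iteration is unrolled into the
program. The list is in variable `1`; assigning it to itself is the empty program. -/
def Prog.expandIter : ℕ → Prog σ W P
  | 0 => .assign 1 (.var 1)
  | n + 1 => .seq (expandIter n) (.call 1 .expand (.cons .nil (.cons .nil (.var 1))))

theorem Prog.expandIter_execIn [Finite V] (l : List V) (s : ℕ → Val S V)
    (hs : s 1 = Val.elems l) (K n : ℕ) (hK : l.length * (A.degree + 1) ^ n ≤ K) :
    ExecIn acc (expandIter n : Prog σ W P) s
      (Function.update s 1 (Val.elems ((expandList acc)^[n] l)))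
      (2 + n * (18 + K * (A.degree * 21 + (A.degree + 1) * nameLen V + 40))) := by
  induction n with
  | zero => exact ExecIn.assign 1 _ hs (by simp [PExp.cost])
  | succ n ih =>
    have hK' : l.length * (A.degree + 1) ^ n ≤ K :=
      le_trans (Nat.mul_le_mul_left _ (Nat.pow_le_pow_right (Nat.succ_pos _) (Nat.le_succ n))) hK
    have h1 := (ih hK').seq (ExecIn.call 1
      (e := .cons .nil (.cons .nil (.var 1))) (z := .cons .nil (.cons .nil
        (Val.elems ((expandList acc)^[n] l)))) (by simp [PExp.val])
      (Prog.expand_runsIn ((expandList acc)^[n] l)) le_rfl)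
    rw [Function.update_idem] at h1
    rw [Function.iterate_succ_apply']
    refine h1.mono ?_
    have h2 := Nat.mul_le_mul_right (A.degree * 21 + (A.degree + 1) * nameLen V + 40)
      ((length_iterate_expandList_le (acc := acc) l n).trans hK')
    rw [add_one_mul n]
    simp only [PExp.cost]
    omega

/-! ### Enumerating parameter tuples -/

/-- Prefix each tuple of a list by each element of a list. -/
def Prog.extendTuples : Prog σ W P :=
  .fold (.call 0
    (.fold (.assign 0 (.cons (.cons (.hd (.var 0)) (.tl (.tl (.var 0)))) (.hd (.tl (.var 0))))))
    (.cons (.tl (.tl (.var 0))) (.cons (.hd (.tl (.var 0))) (.hd (.var 0)))))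

/-- The `j`-tuples over a list. -/
def tuplesList (l : List V) : (j : ℕ) → List (Fin j → V)
  | 0 => [Fin.elim0]
  | j + 1 => l.foldl (fun s a => ((tuplesList l j).map (Fin.cons a)).reverse ++ s) []

theorem mem_tuplesList (l : List V) (j : ℕ) (v : Fin j → V) :
    v ∈ tuplesList l j ↔ ∀ i, v i ∈ l := by
  induction j with
  | zero => simpa [tuplesList] using Subsingleton.elim _ _
  | succ j ih =>
    rw [tuplesList,
      List.mem_foldl_append (fun a =>
        ((tuplesList l j).map (Fin.cons a : _ → Fin (j + 1) → V)).reverse)]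
    simp only [List.not_mem_nil, false_or, List.mem_reverse, List.mem_map, ih]
    constructor
    · rintro ⟨a, ha, u, hu, rfl⟩
      exact Fin.cases ha hu
    · intro h
      exact ⟨v 0, h 0, Fin.tail v, fun i => h i.succ, Fin.cons_self_tail v⟩

theorem length_tuplesList_le (l : List V) (j : ℕ) : (tuplesList l j).length ≤ l.length ^ j := by
  induction j with
  | zero => simp [tuplesList]
  | succ j ih =>
    have := List.length_foldl_append_le
      (fun a => ((tuplesList l j).map (Fin.cons a : _ → Fin (j + 1) → V)).reverse)
      (l.length ^ j) l [] (by simpa using fun _ _ => ih)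
    rw [pow_succ']
    simpa [tuplesList] using this

/-- A list of tuples as a value. -/
def Val.tuples {j : ℕ} (l : List (Fin j → V)) : Val S V := Val.ofList (l.map Val.tuple)

theorem Prog.extendTuples_runsIn (l : List V) (j : ℕ) :
    (extendTuples : Prog σ W P).RunsIn acc
      (.cons (Val.tuples (tuplesList l j)) (.cons .nil (Val.elems l)))
      (Val.tuples (tuplesList l (j + 1)))
      (12 + l.length * ((tuplesList l j).length * 24 + 36)) := by
  refine (Prog.fold_runsIn (B := (tuplesList l j).length * 24 + 23) _ Val.elem Val.tuples
    (fun s a => ((tuplesList l j).map (Fin.cons a : _ → Fin (j + 1) → V)).reverse ++ s) l [] ?_)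
  intro s a _
  have hin := Prog.fold_runsIn (acc := acc) (B := 11)
    (c := (.assign 0 (.cons (.cons (.hd (.var 0)) (.tl (.tl (.var 0)))) (.hd (.tl (.var 0)))) :
      Prog σ W P)) (.elem a) Val.tuple Val.tuples
    (fun s (v : Fin j → V) => (Fin.cons a v : Fin (j + 1) → V) :: s) (tuplesList l j) s (by
      intro s v _
      refine (ExecIn.assign 0 _ rfl (by simp [PExp.cost])).runsIn ?_
      simp [PExp.val, initStore, Val.hd, Val.tl, Val.tuples, Val.ofList, Val.tuple_cons])
  rw [List.foldl_cons_map] at hin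
  refine (ExecIn.call 0 (z := .cons (.elem a) (.cons (Val.tuples s)
    (Val.tuples (tuplesList l j)))) ?_ hin ?_).runsIn (by simp)
  · simp [PExp.val, initStore, Val.hd, Val.tl]
  · simp only [PExp.cost]
    omega

/-- The start value is the list with the empty tuple as its single entry, so that for `ℓ = 0` each
formula is still tested once. -/
def Prog.tuplesIter : ℕ → Prog σ W P
  | 0 => .assign 2 (.cons .nil .nil)
  | j + 1 => .seq (tuplesIter j) (.call 2 .extendTuples (.cons (.var 2) (.cons .nil (.var 1))))

theorem Prog.tuplesIter_execIn (l : List V) (s : ℕ → Val S V) (hs : s 1 = Val.elems l) (K : ℕ)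
    (hl : l.length ≤ K) (j : ℕ) :
    ExecIn acc (tuplesIter j : Prog σ W P) s
      (Function.update s 2 (Val.tuples (tuplesList l j)))
      (4 + j * (18 + K * ((K + 1) ^ j * 24 + 36))) := by
  induction j with
  | zero =>
    exact ExecIn.assign 2 _ (by simp [PExp.val, Val.tuples, tuplesList, Val.tuple, Val.ofList])
      (by simp [PExp.cost])
  | succ j ih =>
    have h1 := ih.seq (ExecIn.call 2
      (e := .cons (.var 2) (.cons .nil (.var 1))) (z := .cons (Val.tuples (tuplesList l j))
        (.cons .nil (Val.elems l))) (by simp [PExp.val, hs])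
      (Prog.extendTuples_runsIn l j) le_rfl)
    rw [Function.update_idem] at h1
    refine h1.mono ?_
    have h2 : (tuplesList l j).length ≤ (K + 1) ^ j :=
      (length_tuplesList_le l j).trans (Nat.pow_le_pow_left (by omega) j)
    -- The base `K + 1` makes the powers monotone even for `K = 0`, so the bound of the last round
    -- covers all earlier ones.
    have h3 : (K + 1) ^ j ≤ (K + 1) ^ (j + 1) := Nat.pow_le_pow_right (by omega) (by omega)
    have h4 : l.length * ((tuplesList l j).length * 24 + 36) ≤ K * ((K + 1) ^ (j + 1) * 24 + 36) :=
      Nat.mul_le_mul hl (by omega)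
    have h5 : j * (18 + K * ((K + 1) ^ j * 24 + 36)) ≤
        j * (18 + K * ((K + 1) ^ (j + 1) * 24 + 36)) := by gcongr
    rw [add_one_mul j]
    simp only [PExp.cost]
    omega

/-! ### Testing hypotheses and searching -/

/-- The expression for the concatenation of a list of length `k` and another list. -/
def PExp.append : ℕ → PExp σ W P → PExp σ W P → PExp σ W P
  | 0, _, e' => e'
  | k + 1, e, e' => .cons (.hd e) (append k (.tl e) e')

theorem PExp.append_val (l l' : List (Val S V)) (e e' : PExp σ W P)
    (he : e.val acc s = Val.ofList l) (he' : e'.val acc s = Val.ofList l') :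
    (PExp.append l.length e e').val acc s = Val.ofList (l ++ l') := by
  induction l generalizing e with
  | nil => exact he'
  | cons a l ih =>
    simp only [List.length_cons, append, PExp.val, List.cons_append, Val.ofList]
    rw [ih (.tl e) (by simp [PExp.val, he, Val.ofList, Val.tl]), he]
    rfl

/-- Quadratic in `k`, because `e` is evaluated anew for each entry, each time under one more `tl`.
-/
theorem PExp.append_cost_le (k : ℕ) (e e' : PExp σ W P) :
    (PExp.append k e e').cost acc s ≤ k * (e.cost acc s + k + 2) + e'.cost acc s := by
  induction k generalizing e with
  | zero => simp [append]
  | succ k ih =>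
    have := ih (.tl e)
    simp only [append, PExp.cost] at this ⊢
    nlinarith

/-- Check whether the answer of `c` on one training example is right. -/
def Prog.checkExample (k : ℕ) (c : Prog σ W P) : Prog σ W P :=
  .seq (.call 1 c (.append k (.hd (.tl (.tl (.var 0)))) (.hd (.var 0)))) <|
  .ite (.var 1)
    (.ite (.tl (.tl (.tl (.var 0)))) (.assign 0 (.hd (.tl (.var 0)))) (.assign 0 .nil))
    (.ite (.tl (.tl (.tl (.var 0)))) (.assign 0 .nil) (.assign 0 (.hd (.tl (.var 0)))))

theorem Prog.checkExample_runsIn {k ℓ : ℕ} (a : Fin k → V) (v : Fin ℓ → V) (b ok d : Bool)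
    {y : Val S V} (hc : c.RunsIn acc (Val.tuple (Fin.append a v)) y B) (hy : y ≠ .nil ↔ d = true) :
    (checkExample k c).RunsIn acc
      (.cons (Val.tuple v) (.cons (Val.bool ok) (.cons (Val.tuple a) (Val.bool b))))
      (Val.bool (ok && (d == b))) (B + (k * (k + 6) + 14)) := by
  have hval : (PExp.append k (.hd (.tl (.tl (.var 0)))) (.hd (.var 0)) : PExp σ W P).val acc
      (initStore (.cons (Val.tuple v) (.cons (Val.bool ok) (.cons (Val.tuple a) (Val.bool b))))) =
      Val.tuple (Fin.append a v) := by
    have := PExp.append_val (acc := acc)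
      (s := initStore (.cons (Val.tuple v) (.cons (Val.bool ok) (.cons (Val.tuple a) (Val.bool b)))))
      (List.ofFn fun i => Val.elem (a i)) (List.ofFn fun i => Val.elem (v i))
      (.hd (.tl (.tl (.var 0))) : PExp σ W P) (.hd (.var 0))
      (by simp [PExp.val, initStore, Val.hd, Val.tl, Val.tuple])
      (by simp [PExp.val, initStore, Val.hd, Val.tuple])
    rw [List.length_ofFn] at this
    rw [this, Val.tuple_eq_elems, Val.elems, List.ofFn_fin_append, List.map_append, List.map_ofFn,
      List.map_ofFn]
    rfl
  have hcost := PExp.append_cost_le (acc := acc)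
      (s := initStore (.cons (Val.tuple v) (.cons (Val.bool ok) (.cons (Val.tuple a) (Val.bool b)))))
      k (.hd (.tl (.tl (.var 0))) : PExp σ W P) (.hd (.var 0))
  simp only [PExp.cost] at hcost
  refine (((ExecIn.call (B' := B + (k * (k + 6) + 3)) 1 hval hc ?_).seq
    (ExecIn.ite (s' := Function.update (Function.update (initStore
      (.cons (Val.tuple v) (.cons (Val.bool ok) (.cons (Val.tuple a) (Val.bool b))))) 1 y) 0
      (Val.bool (ok && (d == b)))) (B := 9) ?_ ?_ le_rfl)).mono ?_).runsIn (by simp)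
  · have : k * (1 + 1 + 1 + 1 + k + 2) = k * (k + 6) := by ring
    omega
  · intro h
    have hd : d = true := hy.1 (by simpa [PExp.val] using h)
    refine ExecIn.ite (B := 4) ?_ ?_ (by simp [PExp.cost])
    · intro h'
      have hb : b = true := by
        cases b
        · simp [PExp.val, initStore, Val.tl, Val.bool] at h'
        · rfl
      refine ExecIn.assign 0 _ ?_ (by simp [PExp.cost])
      simp [PExp.val, initStore, Val.hd, Val.tl, hd, hb]
    · intro h'
      have hb : b = false := by
        cases b
        · rfl
        · simp [PExp.val, initStore, Val.tl, Val.bool] at h'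
      refine ExecIn.assign 0 _ ?_ (by simp [PExp.cost])
      simp [PExp.val, hd, hb, Val.bool]
  · intro h
    have hd : d = false := by
      rw [← Bool.not_eq_true, ← hy, not_not]
      simpa [PExp.val] using h
    refine ExecIn.ite (B := 4) ?_ ?_ (by simp [PExp.cost])
    · intro h'
      have hb : b = true := by
        cases b
        · simp [PExp.val, initStore, Val.tl, Val.bool] at h'
        · rfl
      refine ExecIn.assign 0 _ ?_ (by simp [PExp.cost])
      simp [PExp.val, hd, hb, Val.bool]
    · intro h'
      have hb : b = false := by
        cases b
        · rfl
        · simp [PExp.val, initStore, Val.tl, Val.bool] at h'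
      refine ExecIn.assign 0 _ ?_ (by simp [PExp.cost])
      simp [PExp.val, initStore, Val.hd, Val.tl, hd, hb]
  · simp only [PExp.cost]
    omega

theorem Prog.check_runsIn {k ℓ : ℕ} (v : Fin ℓ → V) (h : (Fin k → V) → Bool)
    (hc : ∀ a : Fin k → V, ∃ y : Val S V, c.RunsIn acc (Val.tuple (Fin.append a v)) y B ∧
      (y ≠ .nil ↔ h a = true)) (T : List ((Fin k → V) × Bool)) :
    (checkExample k c).fold.RunsIn acc
      (.cons (Val.tuple v) (.cons (Val.bool true) (Val.training T)))
      (Val.bool (T.all fun p => h p.1 == p.2)) (12 + T.length * (B + (k * (k + 6) + 27))) := by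
  have h1 := Prog.fold_runsIn (acc := acc) (B := B + (k * (k + 6) + 14)) (c := checkExample k c)
    (Val.tuple v) (fun p : (Fin k → V) × Bool => .cons (Val.tuple p.1) (Val.bool p.2)) Val.bool
    (fun ok p => ok && (h p.1 == p.2)) T true (by
      intro ok p _
      obtain ⟨y, hy, hy'⟩ := hc p.1
      exact checkExample_runsIn p.1 v p.2 ok (h p.1) hy hy')
  have h2 : ∀ (T : List ((Fin k → V) × Bool)) (ok : Bool),
      T.foldl (fun ok p => ok && (h p.1 == p.2)) ok = (ok && T.all fun p => h p.1 == p.2) := by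
    intro T
    induction T with
    | nil => simp
    | cons p T ih => intro ok; simp [ih, Bool.and_assoc]
  rw [h2, Bool.true_and] at h1
  exact h1.mono (by rw [Nat.add_assoc B _ 13])

def PExp.num : ℕ → PExp σ W P
  | 0 => .nil
  | n + 1 => .cons .nil (num n)

theorem PExp.num_val (n : ℕ) : (PExp.num n : PExp σ W P).val acc s = Val.num n := by
  induction n with
  | zero => rfl
  | succ n ih => simp [num, PExp.val, Val.num, ih]

theorem PExp.num_cost (n : ℕ) : (PExp.num n : PExp σ W P).cost acc s = 2 * n + 1 := by
  induction n with
  | zero => rfl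
  | succ n ih => simp only [num, PExp.cost, ih]; omega

/-- Search a list of parameter tuples for one with which `c` is right on all training examples. -/
def Prog.search (k i : ℕ) (c : Prog σ W P) : Prog σ W P :=
  .fold <| .seq
    (.call 1 (checkExample k c).fold
      (.cons (.tl (.tl (.var 0))) (.cons (.cons .nil .nil) (.hd (.var 0)))))
    (.ite (.var 1) (.assign 0 (.cons (.num i) (.tl (.tl (.var 0))))) (.assign 0 (.hd (.tl (.var 0)))))

/-- The result of a search as a value. -/
def Val.hypothesis {N ℓ : ℕ} : Option (Fin N × (Fin ℓ → V)) → Val S V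
  | none => .nil
  | some (i, v) => .cons (Val.num i) (Val.tuple v)

theorem Prog.search_runsIn {N k ℓ : ℕ} (i : Fin N) (h : (Fin ℓ → V) → (Fin k → V) → Bool)
    (hc : ∀ (v : Fin ℓ → V) (a : Fin k → V), ∃ y : Val S V,
      c.RunsIn acc (Val.tuple (Fin.append a v)) y B ∧ (y ≠ .nil ↔ h v a = true))
    (T : List ((Fin k → V) × Bool)) (l : List (Fin ℓ → V)) (o : Option (Fin N × (Fin ℓ → V))) :
    (search k i c).RunsIn acc (.cons (Val.training T) (.cons (Val.hypothesis o) (Val.tuples l)))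
      (Val.hypothesis (l.foldl
        (fun o v => if (T.all fun p => h v p.1 == p.2) then some (i, v) else o) o))
      (12 + l.length * (T.length * (B + (k * (k + 6) + 27)) + (2 * N + 50))) := by
  refine (Prog.fold_runsIn (B := T.length * (B + (k * (k + 6) + 27)) + (2 * N + 37)) _ Val.tuple
    Val.hypothesis
    (fun o v => if (T.all fun p => h v p.1 == p.2) then some (i, v) else o) l o ?_).mono
    (by rw [Nat.add_assoc _ _ 13])
  intro o v _
  refine (((ExecIn.call (B' := 12 + T.length * (B + (k * (k + 6) + 27)) + 11) 1
    (z := .cons (Val.tuple v) (.cons (Val.bool true) (Val.training T))) ?_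
    (check_runsIn v (h v) (hc v) T) ?_).seq
    (ExecIn.ite (s' := Function.update (Function.update (initStore
      (.cons (Val.training T) (.cons (Val.hypothesis o) (Val.tuple v)))) 1
        (Val.bool (T.all fun p => h v p.1 == p.2))) 0
      (Val.hypothesis (if (T.all fun p => h v p.1 == p.2) then some (i, v) else o)))
      (B := 2 * N + 6) ?_ ?_ le_rfl)).mono ?_).runsIn (by simp)
  · simp [PExp.val, initStore, Val.hd, Val.tl, Val.bool]
  · simp only [PExp.cost]
    omega
  · intro hne
    have ht : (T.all fun p => h v p.1 == p.2) = true := by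
      cases hh : (T.all fun p => h v p.1 == p.2)
      · simp [PExp.val, hh, Val.bool] at hne
      · rfl
    refine ExecIn.assign 0 _ ?_ ?_
    · rw [if_pos ht]
      simp [PExp.val, PExp.num_val, initStore, Val.tl, Val.hypothesis]
    · have := i.2
      simp only [PExp.cost, PExp.num_cost]
      omega
  · intro he
    have ht : (T.all fun p => h v p.1 == p.2) = false := by
      cases hh : (T.all fun p => h v p.1 == p.2)
      · rfl
      · simp [PExp.val, hh, Val.bool] at he
    refine ExecIn.assign 0 _ ?_ ?_
    · rw [if_neg (by simp [ht])]
      simp [PExp.val, initStore, Val.hd, Val.tl]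
    · simp only [PExp.cost]
      omega
  · simp only [PExp.cost]
    omega

/-- Each formula has its own model checker, so the loop over the formulas is unrolled too. Variable
`3` carries the best result so far, and later hits overwrite earlier ones. -/
def Prog.searchIter {N : ℕ} (k : ℕ) (mc : Fin N → Prog σ W P) : List (Fin N) → Prog σ W P
  | [] => .assign 3 .nil
  | i :: is => .seq (searchIter k mc is)
      (.call 3 (.search k i (mc i)) (.cons (.var 0) (.cons (.var 3) (.var 2))))

/-- The result of the search over the formulas `is` and the parameter tuples `l`. -/
def searchResult {N k ℓ : ℕ} (h : Fin N → (Fin ℓ → V) → (Fin k → V) → Bool)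
    (T : List ((Fin k → V) × Bool)) (l : List (Fin ℓ → V)) :
    List (Fin N) → Option (Fin N × (Fin ℓ → V))
  | [] => none
  | i :: is => l.foldl (fun o v => if (T.all fun p => h i v p.1 == p.2) then some (i, v) else o)
      (searchResult h T l is)

theorem List.foldl_ite_some {α β : Type} (q : α → Bool) (f : α → β) (l : List α) (o : Option β) :
    (l.foldl (fun o v => if q v then some (f v) else o) o = o ∧ ∀ v ∈ l, q v = false) ∨
      ∃ v ∈ l, q v = true ∧ l.foldl (fun o v => if q v then some (f v) else o) o = some (f v) := by
  induction l generalizing o with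
  | nil => simp
  | cons a l ih =>
    simp only [List.foldl_cons]
    rcases ih (if q a then some (f a) else o) with ⟨h1, h2⟩ | ⟨v, hv, h1, h2⟩
    · rw [h1]
      cases hq : q a
      · exact Or.inl ⟨by simp, by simpa [hq] using h2⟩
      · exact Or.inr ⟨a, by simp, hq, by simp⟩
    · exact Or.inr ⟨v, by simp [hv], h1, h2⟩

theorem searchResult_spec {N k ℓ : ℕ} (h : Fin N → (Fin ℓ → V) → (Fin k → V) → Bool)
    (T : List ((Fin k → V) × Bool)) (l : List (Fin ℓ → V)) (is : List (Fin N)) :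
    (searchResult h T l is = none ∧ ∀ i ∈ is, ∀ v ∈ l, ¬ Consistent (h i v) T) ∨
      ∃ i, ∃ v ∈ l, Consistent (h i v) T ∧ searchResult h T l is = some (i, v) := by
  have hall : ∀ i v, (T.all fun p => h i v p.1 == p.2) = true ↔ Consistent (h i v) T := by
    intro i v
    simp only [List.all_eq_true, beq_iff_eq, Consistent]
  induction is with
  | nil => simp [searchResult]
  | cons i is ih =>
    simp only [searchResult]
    rcases List.foldl_ite_some (fun v => T.all fun p => h i v p.1 == p.2) (fun v => (i, v)) l
      (searchResult h T l is) with ⟨h1, h2⟩ | ⟨v, hv, h1, h2⟩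
    · rw [h1]
      rcases ih with ⟨h3, h4⟩ | h3
      · refine Or.inl ⟨h3, fun j hj v hv => ?_⟩
        rcases List.mem_cons.1 hj with rfl | hj
        · rw [← hall, h2 v hv]; simp
        · exact h4 j hj v hv
      · exact Or.inr h3
    · exact Or.inr ⟨i, v, hv, (hall i v).1 h1, h2⟩

theorem Prog.searchIter_execIn {N k ℓ : ℕ} (mc : Fin N → Prog σ W P)
    (h : Fin N → (Fin ℓ → V) → (Fin k → V) → Bool)
    (hc : ∀ (i : Fin N) (v : Fin ℓ → V) (a : Fin k → V), ∃ y : Val S V,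
      (mc i).RunsIn acc (Val.tuple (Fin.append a v)) y B ∧ (y ≠ .nil ↔ h i v a = true))
    (T : List ((Fin k → V) × Bool)) (l : List (Fin ℓ → V)) (s : ℕ → Val S V)
    (h0 : s 0 = Val.training T) (h2 : s 2 = Val.tuples l) (is : List (Fin N)) :
    ExecIn acc (searchIter k mc is) s
      (Function.update s 3 (Val.hypothesis (searchResult h T l is)))
      (2 + is.length *
        (18 + l.length * (T.length * (B + (k * (k + 6) + 27)) + (2 * N + 50)))) := by
  induction is with
  | nil =>
    exact ExecIn.assign 3 _ (by simp [PExp.val, searchResult, Val.hypothesis])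
      (by simp [PExp.cost])
  | cons i is ih =>
    have h1 := ih.seq (ExecIn.call 3
      (e := .cons (.var 0) (.cons (.var 3) (.var 2))) (z := .cons (Val.training T)
        (.cons (Val.hypothesis (searchResult h T l is)) (Val.tuples l)))
      (by simp [PExp.val, h0, h2])
      (Prog.search_runsIn i (h i) (hc i) T l (searchResult h T l is)) le_rfl)
    rw [Function.update_idem] at h1
    refine h1.mono ?_
    rw [List.length_cons, add_one_mul is.length]
    simp only [PExp.cost]
    omega

/-- Try all formulas and all parameter tuples in the `R`-neighbourhood of the training
examples. -/
def Prog.learner {N : ℕ} (k ℓ R : ℕ) (mc : Fin N → Prog σ W P) : Prog σ W P :=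
  .seq (.call 1 .collect (.cons .nil (.cons .nil (.var 0)))) <|
  .seq (expandIter R) <|
  .seq (tuplesIter ℓ) <|
  .seq (searchIter k mc (List.finRange N)) <|
  .assign 0 (.var 3)

/-- `K` bounds the length of the list of candidate elements and `(K + 1) ^ ℓ` the number of
parameter tuples. The summands are the times for collecting, expanding, forming tuples, searching
and returning the result. -/
theorem Prog.learner_runsIn [Finite V] {N k ℓ : ℕ} (R : ℕ) (mc : Fin N → Prog σ W P)
    (h : Fin N → (Fin ℓ → V) → (Fin k → V) → Bool)
    (hc : ∀ (i : Fin N) (v : Fin ℓ → V) (a : Fin k → V), ∃ y : Val S V,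
      (mc i).RunsIn acc (Val.tuple (Fin.append a v)) y B ∧ (y ≠ .nil ↔ h i v a = true))
    (T : List ((Fin k → V) × Bool)) (K : ℕ) (hK : T.length * k * (A.degree + 1) ^ R ≤ K) :
    (learner k ℓ R mc).RunsIn acc (Val.training T) (Val.hypothesis (searchResult h T
        (tuplesList ((expandList acc)^[R] (collectList T)) ℓ) (List.finRange N)))
      ((18 + T.length * (k * 21 + 36)) +
        ((2 + R * (18 + K * (A.degree * 21 + (A.degree + 1) * nameLen V + 40))) +
        ((4 + ℓ * (18 + K * ((K + 1) ^ ℓ * 24 + 36))) +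
        ((2 + N * (18 + (K + 1) ^ ℓ * (T.length * (B + (k * (k + 6) + 27)) + (2 * N + 50)))) +
        2)))) := by
  have hlen : (collectList T).length * (A.degree + 1) ^ R ≤ K :=
    (Nat.mul_le_mul_right _ (length_collectList_le T)).trans hK
  have hlen' : ((expandList acc)^[R] (collectList T)).length ≤ K :=
    (length_iterate_expandList_le _ _).trans hlen
  have hlen'' : (tuplesList ((expandList acc)^[R] (collectList T)) ℓ).length ≤ (K + 1) ^ ℓ :=
    (length_tuplesList_le _ _).trans (Nat.pow_le_pow_left (by omega) ℓ)
  refine ExecIn.runsIn ((ExecIn.call 1 (z := .cons .nil (.cons .nil (Val.training T)))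
    (by simp [PExp.val, initStore]) (collect_runsIn T) (by simp only [PExp.cost]; omega)).seq
    ((expandIter_execIn (collectList T) _ (by simp) K R hlen).seq
    ((tuplesIter_execIn ((expandList acc)^[R] (collectList T)) _ (by simp) K hlen' ℓ).seq
    (((searchIter_execIn mc h hc T
      (tuplesList ((expandList acc)^[R] (collectList T)) ℓ) _ (by simp [initStore]) (by simp) (List.finRange N)).mono
      ?_).seq
    (ExecIn.assign 0 _ rfl (by simp [PExp.cost])))))) (by simp [PExp.val])
  rw [List.length_finRange]
  gcongr

end Programs

end


/-! ### The running time is polynomial -/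

section Bounds

/-- Polynomially bounded functions. -/
def PolyBounded (p : ℕ → ℕ) : Prop := ∃ C c : ℕ, ∀ m, 0 < m → p m ≤ C * m ^ c

/-- Functions bounded by the product of their second argument and a polynomial in the first. -/
def LinPolyBounded (g : ℕ → ℕ → ℕ) : Prop :=
  ∃ C c : ℕ, ∀ m f, 0 < m → 0 < f → g m f ≤ C * f * m ^ c

namespace PolyBounded

variable {p q : ℕ → ℕ}

theorem const (a : ℕ) : PolyBounded fun _ => a := ⟨a, 0, by simp⟩

theorem id : PolyBounded fun m => m := ⟨1, 1, by simp⟩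

theorem add (hp : PolyBounded p) (hq : PolyBounded q) : PolyBounded fun m => p m + q m := by
  obtain ⟨C, c, h⟩ := hp
  obtain ⟨D, d, h'⟩ := hq
  refine ⟨C + D, c + d, fun m hm => ?_⟩
  rw [Nat.add_mul]
  exact Nat.add_le_add
    ((h m hm).trans (Nat.mul_le_mul_left _ (Nat.pow_le_pow_right hm (Nat.le_add_right c d))))
    ((h' m hm).trans (Nat.mul_le_mul_left _ (Nat.pow_le_pow_right hm (Nat.le_add_left d c))))

theorem mul (hp : PolyBounded p) (hq : PolyBounded q) : PolyBounded fun m => p m * q m := by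
  obtain ⟨C, c, h⟩ := hp
  obtain ⟨D, d, h'⟩ := hq
  refine ⟨C * D, c + d, fun m hm => (Nat.mul_le_mul (h m hm) (h' m hm)).trans (le_of_eq ?_)⟩
  ring

theorem pow (hp : PolyBounded p) (n : ℕ) : PolyBounded fun m => p m ^ n := by
  induction n with
  | zero => simpa using const 1
  | succ n ih => simpa [pow_succ] using ih.mul hp

theorem linPolyBounded (hp : PolyBounded p) : LinPolyBounded fun m _ => p m := by
  obtain ⟨C, c, h⟩ := hp
  exact ⟨C, c, fun m f hm hf => (h m hm).trans
    (Nat.mul_le_mul_right _ (Nat.le_mul_of_pos_right C hf))⟩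

end PolyBounded

namespace LinPolyBounded

variable {g g' : ℕ → ℕ → ℕ} {p : ℕ → ℕ}

theorem snd : LinPolyBounded fun _ f => f := ⟨1, 0, by simp⟩

theorem add (hg : LinPolyBounded g) (hg' : LinPolyBounded g') :
    LinPolyBounded fun m f => g m f + g' m f := by
  obtain ⟨C, c, h⟩ := hg
  obtain ⟨D, d, h'⟩ := hg'
  refine ⟨C + D, c + d, fun m f hm hf => ?_⟩
  rw [Nat.add_mul, Nat.add_mul]
  exact Nat.add_le_add
    ((h m f hm hf).trans (Nat.mul_le_mul_left _ (Nat.pow_le_pow_right hm (Nat.le_add_right c d))))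
    ((h' m f hm hf).trans (Nat.mul_le_mul_left _ (Nat.pow_le_pow_right hm (Nat.le_add_left d c))))

theorem poly_mul (hp : PolyBounded p) (hg : LinPolyBounded g) :
    LinPolyBounded fun m f => p m * g m f := by
  obtain ⟨C, c, h⟩ := hp
  obtain ⟨D, d, h'⟩ := hg
  refine ⟨C * D, c + d, fun m f hm hf =>
    (Nat.mul_le_mul (h m hm) (h' m f hm hf)).trans (le_of_eq ?_)⟩
  ring

end LinPolyBounded

/-- The bound of `Prog.learner_runsIn` with `m` in place of the length of the sample, the degree and
the name length, and with `K = m * k * m ^ R`. The model-checking time `f` occurs once, multiplied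
only by polynomials in `m`, so it stays linear. -/
theorem learnerTime_linPolyBounded (k ℓ R N : ℕ) :
    LinPolyBounded fun m f =>
      (18 + m * (k * 21 + 36)) +
        ((2 + R * (18 + m * k * m ^ R * (m * 21 + m * m + 40))) +
        ((4 + ℓ * (18 + m * k * m ^ R * ((m * k * m ^ R + 1) ^ ℓ * 24 + 36))) +
        ((2 + N * (18 + (m * k * m ^ R + 1) ^ ℓ * (m * (f + (k * (k + 6) + 27)) + (2 * N + 50)))) +
        2))) := by
  have c : ∀ a : ℕ, PolyBounded fun _ => a := PolyBounded.const
  have x : PolyBounded fun m => m := PolyBounded.id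
  have hK : PolyBounded fun m => m * k * m ^ R := (x.mul (c k)).mul (x.pow R)
  have hM : PolyBounded fun m => (m * k * m ^ R + 1) ^ ℓ := (hK.add (c 1)).pow ℓ
  have h1 : PolyBounded fun m => 18 + m * (k * 21 + 36) := (c _).add (x.mul (c _))
  have h2 : PolyBounded fun m => 2 + R * (18 + m * k * m ^ R * (m * 21 + m * m + 40)) :=
    (c _).add ((c _).mul ((c _).add (hK.mul (((x.mul (c _)).add (x.mul x)).add (c _)))))
  have h3 : PolyBounded fun m =>
      4 + ℓ * (18 + m * k * m ^ R * ((m * k * m ^ R + 1) ^ ℓ * 24 + 36)) :=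
    (c _).add ((c _).mul ((c _).add (hK.mul ((hM.mul (c _)).add (c _)))))
  have l : ∀ a : ℕ, LinPolyBounded fun _ _ => a := fun a => (c a).linPolyBounded
  have h4 : LinPolyBounded fun m f =>
      2 + N * (18 + (m * k * m ^ R + 1) ^ ℓ * (m * (f + (k * (k + 6) + 27)) + (2 * N + 50))) :=
    (l _).add (.poly_mul (c _) ((l _).add (.poly_mul hM
      ((LinPolyBounded.poly_mul x (LinPolyBounded.snd.add (l _))).add (l _)))))
  exact h1.linPolyBounded.add (h2.linPolyBounded.add (h3.linPolyBounded.add (h4.add (l 2))))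

end Bounds

/-! ### The learning theorem -/

theorem mainTheorem9 {S : WeightColl} (P : PredColl S) (W : WSig S) (σ σs : Sig)
    (k ℓ r N : ℕ) (L : WLogic.{u} σ W) (Ls : WLogic.{v} σs W)
    (Φ : Set L.Formula) (Φs : Fin N → Ls.Formula)
    (hΦ : HasLocalNormalForms k ℓ r Φ (Set.range Φs)) :
    ∃ C c : ℕ, ∀ mc : Fin N → Prog σs W P, ∃ learner : Prog σs W P,
      ∀ (V : Type) [Finite V] [Nonempty V] (A : WStr σ W V) (As : WStr σs W V),
        A.IsWeighted → IsAssociated k ℓ Φ (Set.range Φs) A As →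
        ∀ f : ℕ, 0 < f → ModelChecksWithin k ℓ Φs mc As f →
        ∀ (acc : As.Access) (T : List ((Fin k → V) × Bool)),
          (ℓ = 0 ∨ (0 < k ∧ T ≠ [])) →
          ∃ (y : Val S V) (time : ℕ), learner.Runs acc (Val.training T) y time ∧
            time ≤ C * f * (Nat.log 2 (Nat.card V) + As.degree + T.length + 1) ^ c ∧
            ((∃ (i : Fin N) (v : Fin ℓ → V),
                y = .cons (Val.num i) (Val.tuple v) ∧
                Consistent (Ls.concept As (Φs i) v) T ∧
                ∀ j, v j ∈ As.ball ((2 * r + 1) * ℓ) (trainingElems T)) ∨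
              (y = .nil ∧ ∀ h ∈ L.conceptClass Φ A k ℓ, ¬ Consistent h T)) := by
  -- The constants depend only on `k`, `ℓ`, `r` and `N`, so they are fixed before the model checkers
  -- are given.
  obtain ⟨C, c, hC⟩ := learnerTime_linPolyBounded k ℓ ((2 * r + 1) * ℓ) N
  refine ⟨C, c, fun mc => ⟨Prog.learner k ℓ ((2 * r + 1) * ℓ) mc, ?_⟩⟩
  intro V _ _ A As _ hAs f hf hmc acc T hT
  -- The summand `1` makes `m` positive and absorbs the `+ 1` in the name length and in `As.degree +
  -- 1`.
  set m := Nat.log 2 (Nat.card V) + As.degree + T.length + 1 with hm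
  have hlen : T.length ≤ m := by omega
  have hdeg : As.degree + 1 ≤ m := by omega
  have hname : nameLen V ≤ m := by rw [nameLen]; omega
  have hmc' : ∀ (i : Fin N) (v : Fin ℓ → V) (a : Fin k → V), ∃ y : Val S V,
      (mc i).RunsIn acc (Val.tuple (Fin.append a v)) y f ∧
        (y ≠ .nil ↔ Ls.concept As (Φs i) v a = true) := by
    intro i v a
    obtain ⟨y, t, hrun, ht, hy⟩ := hmc acc i a v
    exact ⟨y, ⟨t, ht, hrun⟩, by rw [hy]; simp [WLogic.concept]⟩
  have hball : ∀ v : Fin ℓ → V,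
      v ∈ tuplesList ((expandList acc)^[(2 * r + 1) * ℓ] (collectList T)) ℓ ↔
        ∀ j, v j ∈ As.ball ((2 * r + 1) * ℓ) (trainingElems T) := by
    intro v
    have hset : {a | a ∈ collectList T} = trainingElems T := Set.ext (mem_collectList T)
    simp only [mem_tuplesList, mem_iterate_expandList, hset]
  obtain ⟨t, ht, hrun⟩ := Prog.learner_runsIn ((2 * r + 1) * ℓ) mc
    (fun i v => Ls.concept As (Φs i) v) hmc' T (m * k * m ^ ((2 * r + 1) * ℓ)) (by gcongr)
  refine ⟨_, t, hrun, ht.trans (le_trans ?_ (hC m f (by omega) hf)), ?_⟩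
  · have hdeg' : As.degree ≤ m := by omega
    beta_reduce
    gcongr
  rcases searchResult_spec (fun i v => Ls.concept As (Φs i) v) T
    (tuplesList ((expandList acc)^[(2 * r + 1) * ℓ] (collectList T)) ℓ) (List.finRange N) with
    ⟨hnone, hall⟩ | ⟨i, v, hv, hcons, hsome⟩
  · refine Or.inr ⟨by rw [hnone]; rfl, ?_⟩
    rintro _ ⟨φ, hφ, v, rfl⟩ hcons
    obtain ⟨ψ, hψ, hφψ⟩ := hAs.2 φ hφ
    -- Far parameters are reset to a training element, so one must exist unless there are no
    -- parameters.
    have hX : ℓ = 0 ∨ (trainingElems T).Nonempty := by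
      refine hT.imp_right ?_
      rintro ⟨hk, hne⟩
      obtain ⟨p, hp⟩ := List.exists_mem_of_ne_nil T hne
      exact ⟨p.1 ⟨0, hk⟩, p, hp, _, rfl⟩
    -- A consistent concept on `A` passes to `As` by association, and then to near parameters with
    -- the same values on the training tuples; the failed search had already excluded that
    -- candidate.
    obtain ⟨_, ⟨i, rfl⟩, v', hv', heq⟩ := hΦ.exists_near_hypothesis hAs.1 hX hψ v
    refine hall i (List.mem_finRange i) v' ((hball v').2 hv') fun p hp => ?_
    rw [← hcons p hp]
    simp only [WLogic.concept, decide_eq_decide]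
    rw [hφψ, heq p.1 fun j => ⟨p, hp, j, rfl⟩]
  · exact Or.inl ⟨i, v, by rw [hsome]; rfl, hcons, (hball v).1 hv⟩
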